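/- **Setting.** Let $A$ be a countable alphabet, enumerated as $1,2,\dots$. For strings of past symbols write $vw$ for the string with most recent part $v$ and older part $w$ (if $v$ is infinite, $vw=v$). A *kernel* is a function $P(a\mid x)\ge 0$ of $a\in A$ and of an infinite past $x=(\dots,a_{-2},a_{-1})$ with $\sum_{a}P(a\mid x)=1$ for every $x$. Put $\alpha(a)=\inf_z P(a\mid z)$ and $\alpha_{-1}=\sum_a\alpha(a)$. A *context tree* $\tau$ is a set of finite or infinite strings such that every infinite past $x$ ends with exactly one element $c_\tau(x)$ of $\tau$, and no element of $\tau$ is a proper suffix of another one. It is a *skeleton* if it is the smallest context tree (in the order by pruning) that contains its own infinite contexts; $\{\emptyset\}$ is a skeleton. For a finite $v\in\tau$, $k\ge 0$, and $i\ge 0$ let $$\bar\alpha_k^v=\inf_{v_1,\dots,v_k\in\tau}\ \sum_{a\in A}\inf_z P(a\mid v v_1\cdots v_k z),\qquad \bar\alpha_k^i=\inf_{v\in\tau,\ |v|\le i}\bar\alpha_k^v ,$$ the second infimum being over finite contexts. $P$ is *extended locally continuous* with respect to $\tau$ if $\bar\alpha_k^v\to 1$ as $k\to\infty$ for every finite $v\in\tau$.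 Let $(U_i)_{i\in\mathbb Z}$ be i.i.d. uniform on $[0,1)$. Put $Y_i=a$ if $\sum_{b<a}\alpha(b)\le U_i<\sum_{b\le a}\alpha(b)$, and $Y_i=\star$ if $U_i\ge\alpha_{-1}$. For $\mathbf a\in A^{\mathbb Z}$ let $Y_i(\mathbf a)$ be $Y_i$ if $Y_i\in A$ and $a_i$ if $Y_i=\star$; let $c_\tau^n=\sup_{\mathbf a}|c_\tau(\dots Y_{n-1}(\mathbf a)Y_n(\mathbf a))|$. A time $i\le 0$ is a *good coalescence time* for time $0$ if for every $j\in\{i,\dots,0\}$ either $Y_j\in A$ or $c_\tau^{j-1}\le j-i$. An *update function* for $P$ is a function $F(x,t)\in A$ of an infinite past $x$ and $t\in[0,1)$ such that $F(x,U_0)$ has law $P(\cdot\mid x)$ for every $x$. Iterating it from time $j$ with initial past $x$ and with $U_j,U_{j+1},\dots$ constructs symbols at the times $j,j+1,\dots$. The coalescence time $\theta[m,n]\in\{-\infty\}\cup\mathbb Z$ is the largest $j\le m$ such that the symbols constructed from time $j$ at the times $m,\dots,n$ do not depend on $x$; $\theta[0]=\theta[0,0]$. The CFTP with update function $F$ is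 *feasible* if $\theta[m,n]>-\infty$ almost surely for all integers $m\le n$. A nonnegative sequence $(c_n)$ decays exponentially fast if $c_n\le Dd^n$ for some $D>0$, $0<d<1$; a random variable $W$ has summable (exponential) tail if $\mathbb P(|W|\ge n)$ is summable (decays exponentially fast). **Theorem.** Let $P$ be extended locally continuous with respect to a skeleton $\tau$. Let $\bar\theta[0]$ be a random time with $\mathbb E|\bar\theta[0]|<\infty$ that is almost surely a good coalescence time for time $0$ and satisfies almost surely $$c_\tau^j\le j-\bar\theta[0]+1\qquad\text{for every } j\in\{\bar\theta[0],\dots,0\}.$$ For $k\ge 0$ put $$\bar A_k=\Big\{1-(\mathbb E|\bar\theta[0]|+1)\,\mathbb P\big(U_0>\bar\alpha_k^{\,c_\tau^{-1}}\big)\Big\}\vee\alpha_{-1}.$$ Then there is an update function $F$ for $P$ whose coalescence time $\theta$ is such that: 1. if $\sum_{k\ge1}\prod_{j=0}^{k-1}\bar A_j=+\infty$, then $\theta[0]$ is almost surely finite; 2. if $\sum_{k\ge0}(1-\bar A_k)<\infty$, then $\theta[0]$ has summable tail; 3. if $\bar\theta[0]$ has exponential tail and $(1-\bar A_k)_{k\ge0}$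 decays exponentially fast to zero, then $\theta[0]$ has exponential tail. In each of these regimes the CFTP with update function $F$ is feasible. -/

import Mathlib

open MeasureTheory ProbabilityTheory Filter Topology

namespace InfiniteChain

universe u

/-! Strings of past symbols are listed from the most recent symbol to the oldest one: an infinite
past `… a₋₂ a₋₁` is the stream `x` with `x n = a₋₍ₙ₊₁₎`, and a finite past is the list
`[a₋₁, …, a₋ₖ]`. Thus `l ++ₛ z` is the past whose most recent symbols are `l`, preceded by `z`. -/

/-- A finite or infinite string of past symbols. -/
inductive PastString (A : Type u) : Type u
  | fin (l : List A) : PastString A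
  | inf (s : Stream' A) : PastString A

namespace PastString

variable {A : Type u}

/-- The length of a string. -/
def length : PastString A → ℕ∞
  | fin l => (l.length : ℕ∞)
  | inf _ => ⊤

/-- The string with recent part `v` and older part `w`; symbols older than an infinite string are
dropped. -/
def append : PastString A → PastString A → PastString A
  | fin l, fin m => fin (l ++ m)
  | fin l, inf s => inf (l ++ₛ s)
  | inf s, _ => inf s

/-- The infinite past with recent part `v`, preceded by `z`. -/
def complete : PastString A → Stream' A → Stream' A
  | fin l, z => l ++ₛ z
  | inf s, _ => s

/-- `v` is a suffix of `w` (in the order of time): it is the recent part of `w`. -/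
def IsSuffix (v w : PastString A) : Prop := ∃ r : PastString A, w = v.append r

/-- The string `v v₁ v₂ … v_k`, where `v` is the most recent part and `v_k` the oldest. -/
def concat (v : PastString A) (vs : List (PastString A)) : PastString A :=
  vs.foldl append v

end PastString

/-- A context tree: a set of finite or infinite strings which partitions the set of infinite pasts
(each past has exactly one of them as a suffix), and in which no string is a proper suffix of
another one. -/
structure ContextTree (A : Type u) where
  contexts : Set (PastString A)
  partition : ∀ x : Stream' A, ∃! v : PastString A, v ∈ contexts ∧ v.IsSuffix (PastString.inf x)
  no_extension : ∀ l : List A, PastString.fin l ∈ contexts →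
    ∀ r : PastString A, r ≠ PastString.fin [] → (PastString.fin l).append r ∉ contexts

namespace ContextTree

variable {A : Type u}

/-- `c_τ(x)`, the unique context of `τ` which is a suffix of `x`. -/
noncomputable def context (τ : ContextTree A) (x : Stream' A) : PastString A :=
  (τ.partition x).choose

/-- `τ` is a subtree of `τ'`: every context of `τ'` ends with a context of `τ`. -/
def IsSubtree (τ τ' : ContextTree A) : Prop :=
  ∀ w ∈ τ'.contexts, ∃ v ∈ τ.contexts, v.IsSuffix w

/-- A skeleton: `τ` is the smallest context tree that contains the infinite contexts of `τ`.
The tree whose only context is the empty string satisfies this. -/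
def IsSkeleton (τ : ContextTree A) : Prop :=
  ∀ τ' : ContextTree A,
    (∀ s : Stream' A, PastString.inf s ∈ τ.contexts → PastString.inf s ∈ τ'.contexts) →
      τ.IsSubtree τ'

end ContextTree

/-- A transition probability kernel: `P a x` is `P(a | x)`. -/
structure PastKernel (A : Type u) where
  prob : A → Stream' A → ℝ
  nonneg : ∀ a x, 0 ≤ prob a x
  hasSum_one : ∀ x, HasSum (fun a => prob a x) 1

namespace PastKernel

variable {A : Type u}

/-- `α(a) = inf_z P(a | z)`. -/
noncomputable def alpha (P : PastKernel A) (a : A) : ℝ := ⨅ z : Stream' A, P.prob a z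

/-- `α₋₁ = ∑ₐ α(a)`. -/
noncomputable def alphaTotal (P : PastKernel A) : ℝ := ∑' a, P.alpha a

/-- `ᾱ_k^v`, the infimum over `v₁, …, v_k ∈ τ` of `∑ₐ inf_z P(a | v v₁ … v_k z)`. -/
noncomputable def extRate (P : PastKernel A) (τ : ContextTree A) (k : ℕ) (v : PastString A) : ℝ :=
  ⨅ w : Fin k → τ.contexts, ∑' a,
    ⨅ z : Stream' A, P.prob a ((v.concat (List.ofFn fun i => (w i : PastString A))).complete z)

/-- `P` is extended locally continuous with respect to `τ`: `ᾱ_k^v → 1` as `k → ∞` for each finite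
context `v` of `τ`. -/
def IsExtLC (P : PastKernel A) (τ : ContextTree A) : Prop :=
  ∀ l : List A, PastString.fin l ∈ τ.contexts →
    Tendsto (fun k => P.extRate τ k (PastString.fin l)) atTop (𝓝 1)

/-- `ᾱ_k^i`, the infimum of `ᾱ_k^v` over the finite contexts `v` of length at most `i`. -/
noncomputable def extRateLength (P : PastKernel A) (τ : ContextTree A) (k : ℕ) (i : ℕ∞) : ℝ :=
  ⨅ l : {l : List A // PastString.fin l ∈ τ.contexts ∧ (l.length : ℕ∞) ≤ i},
    P.extRate τ k (PastString.fin l.1)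

section Driving

variable [Encodable A]

open Classical in
/-- The symbol that a number `t ∈ [0, 1)` forces whatever the past: along the enumeration of `A`, it
is `a` if `∑_{b before a} α(b) ≤ t < ∑_{b before a} α(b) + α(a)`, and it is the additional symbol
`⋆` (here `none`) if `t ≥ α₋₁`. -/
noncomputable def forced (P : PastKernel A) (t : ℝ) : Option A :=
  if h : ∃ a : A,
      (∑' b, if Encodable.encode b < Encodable.encode a then P.alpha b else 0) ≤ t ∧
      t < ∑' b, if Encodable.encode b ≤ Encodable.encode a then P.alpha b else 0
  then some h.choose else none

/-- The past `… Y_{n-1}(a) Y_n(a)`, where `Y_i(a)` is `Y_i` if `Y_i` is in the alphabet, and `a_i`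
if `Y_i = ⋆`. -/
noncomputable def filledPast (P : PastKernel A) (u : ℤ → ℝ) (a : ℤ → A) (n : ℤ) : Stream' A :=
  fun k => (P.forced (u (n - k))).getD (a (n - k))

/-- `c_τ^n`, the supremum over `a` of the length of the context of `… Y_{n-1}(a) Y_n(a)`. -/
noncomputable def maxContextLength (P : PastKernel A) (τ : ContextTree A) (u : ℤ → ℝ) (n : ℤ) :
    ℕ∞ :=
  ⨆ a : ℤ → A, (τ.context (P.filledPast u a n)).length

/-- `i` is a good coalescence time for time `m`: whenever `i ≤ j ≤ m` and `Y_j = ⋆`, the contexts of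
the past of time `j` are contained in the window `{i, …, j - 1}`. -/
def IsGoodTime (P : PastKernel A) (τ : ContextTree A) (u : ℤ → ℝ) (m i : ℤ) : Prop :=
  i ≤ m ∧ ∀ j, i ≤ j → j ≤ m →
    (P.forced (u j)).isSome ∨ P.maxContextLength τ u (j - 1) ≤ ((j - i).toNat : ℕ∞)

/-- For every `j` in `{i, …, m}` the contexts of the past up to and including time `j` are contained
in the window `{i, …, j}`. -/
def ContextsInWindow (P : PastKernel A) (τ : ContextTree A) (u : ℤ → ℝ) (m i : ℤ) : Prop :=
  ∀ j, i ≤ j → j ≤ m → P.maxContextLength τ u j ≤ ((j - i + 1).toNat : ℕ∞)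

end Driving

/-- `F` is an update function for `P`: if `U` is uniform on `[0, 1)` then `F x U` has law
`P(· | x)`. -/
def IsUpdateFunction (P : PastKernel A) (F : Stream' A → ℝ → A) : Prop :=
  ∀ (x : Stream' A) (a : A), MeasurableSet {t : ℝ | t ∈ Set.Ico (0 : ℝ) 1 ∧ F x t = a} ∧
    volume {t : ℝ | t ∈ Set.Ico (0 : ℝ) 1 ∧ F x t = a} = ENNReal.ofReal (P.prob a x)

end PastKernel

section Coalescence

variable {A : Type u}

/-- The past of time `j + n` that arises from the past `x` of time `j` by `n` updates with
`u_j, …, u_{j+n-1}`. -/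
def iteratedPast (F : Stream' A → ℝ → A) (u : ℤ → ℝ) (j : ℤ) (x : Stream' A) : ℕ → Stream' A
  | 0 => x
  | n + 1 => Stream'.cons (F (iteratedPast F u j x n) (u (j + n))) (iteratedPast F u j x n)

/-- `F_{[j, j+n]}(x, u_j, …, u_{j+n})`, the symbol constructed at time `j + n`. -/
def iteratedUpdate (F : Stream' A → ℝ → A) (u : ℤ → ℝ) (j : ℤ) (x : Stream' A) (n : ℕ) : A :=
  F (iteratedPast F u j x n) (u (j + n))

/-- Started at time `j`, the symbols constructed at the times of `{m, …, n}` do not depend on the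
initial past. -/
def Coalesces (F : Stream' A → ℝ → A) (u : ℤ → ℝ) (m n j : ℤ) : Prop :=
  ∀ t : ℕ, m ≤ j + t → j + t ≤ n → ∀ x y : Stream' A,
    iteratedUpdate F u j x t = iteratedUpdate F u j y t

/-- `m - θ[m, n]`, where `θ[m, n]` is the coalescence time of the window `{m, …, n}`, the largest
`j ≤ m` from which the window coalesces; it is `⊤` if there is none (`θ[m, n] = -∞`). In particular
`coalescenceLag F u 0 0` is `|θ[0]|`. -/
noncomputable def coalescenceLag (F : Stream' A → ℝ → A) (u : ℤ → ℝ) (m n : ℤ) : ℕ∞ :=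
  ⨅ (k : ℕ) (_ : Coalesces F u m n (m - k)), (k : ℕ∞)

end Coalescence

/-- A sequence decays exponentially fast to zero. -/
def DecaysExponentially (c : ℕ → ℝ) : Prop :=
  ∃ D > (0 : ℝ), ∃ d : ℝ, 0 < d ∧ d < 1 ∧ ∀ n, c n ≤ D * d ^ n

section Tails

variable {Ω : Type*} [MeasurableSpace Ω]

/-- `W = |θ|` has summable tail. -/
def HasSummableTail (μ : Measure Ω) (W : Ω → ℕ∞) : Prop :=
  Summable fun n : ℕ => μ.real {ω | (n : ℕ∞) ≤ W ω}

/-- `W = |θ|` has exponential tail. -/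
def HasExponentialTail (μ : Measure Ω) (W : Ω → ℕ∞) : Prop :=
  DecaysExponentially fun n : ℕ => μ.real {ω | (n : ℕ∞) ≤ W ω}

/-- The sequence `U` is i.i.d. with the uniform law on `[0, 1)`. -/
def IsIIDUniform (μ : Measure Ω) (U : ℤ → Ω → ℝ) : Prop :=
  (∀ i, Measurable (U i)) ∧ iIndepFun U μ ∧
    ∀ i, μ.map (U i) = volume.restrict (Set.Ico (0 : ℝ) 1)

/-- The coupling from the past with update function `F` is feasible: the coalescence time of each
finite window is almost surely finite. -/
def IsFeasible {A : Type*} (μ : Measure Ω) (U : ℤ → Ω → ℝ) (F : Stream' A → ℝ → A) : Prop :=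
  ∀ m n : ℤ, m ≤ n → ∀ᵐ ω ∂μ, coalescenceLag F (fun i => U i ω) m n < ⊤

/-- `Ā_k = (1 - (E|θ̄| + 1) μ(U₀ > ᾱ_k^{c_τ^{-1}})) ∨ α₋₁`. -/
noncomputable def extA {A : Type*} [Encodable A] (μ : Measure Ω) (U : ℤ → Ω → ℝ)
    (P : PastKernel A) (τ : ContextTree A) (θbar : Ω → ℤ) (k : ℕ) : ℝ :=
  max (1 - ((∫ ω, |(θbar ω : ℝ)| ∂μ) + 1) *
      μ.real {ω | P.extRateLength τ k (P.maxContextLength τ (fun i => U i ω) (-1)) < U 0 ω})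
    P.alphaTotal

end Tails

end InfiniteChain

/-!
The update function `PastKernel.update` splits `[0, 1)` in levels: the first level realizes the
symbols that `P.forced` forces whatever the past, and level `k` the additional mass that is common
to all pasts with the same `k + 1` most recent contexts. Extended local continuity says that the
levels exhaust `[0, 1)`, and below the threshold `ᾱ_k^v` the new symbol depends only on `k + 1`
contexts (`PastKernel.update_congr`).

The driving variables are read backward in time and cut into blocks (`PastKernel.IsBlock`). A block
starts, in time, with a forced symbol and contains all contexts of the pasts of its times. Hence
each block contains at least one context of a parsing of the past
(`PastKernel.contextString_congr`), so that a symbol which needs `k` contexts beyond its own is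
determined by its block and the `k` blocks before it. The shortest block is a stopping time of the
backward filtration and is not longer than the block given by `θ̄[0]`; so the sequence before it is
independent of it and has the law of the whole sequence
(`PastKernel.driveLaw_inter_preimage_dropBlock`). This replaces `θ̄[0]`, which need not be a
stopping time.

Say that `m` is a renewal if none of the first `m` blocks needs more than these blocks. If `p k` is
the probability that a block needs at most `k` older contexts, then `m` is a renewal with
probability `u m = ∏_{j<m} p j`, and a renewal makes the symbol at time `0` coalesce
(`PastKernel.forgets_of_isRenewal`). With `r M` the probability that there is no renewal in
`{1, …, M}`, the decomposition at the last renewal reads `∑_{m≤M} u m * r (M - m) = 1`. It yields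
`r → 0` if `∑ u = ∞`, `∑ r < ∞` if `u` is bounded below, and, by the renewal equation for `r`,
exponential decay of `r` if moreover `1 - p` decays exponentially fast. Wald's identity and
Chernoff's bound carry this over to the lengths of the blocks.

It remains to compare `p` with `Ā`. By Wald's identity, `1 - p k` is at most
`(E|θ̄[0]| + 1) μ(U₀ > ᾱ_k^{c_τ^{-1}})` (`PastKernel.one_sub_needProb_le`). The maximum with `α₋₁`
in `Ā` only affects finitely many factors of the products, up to a trivial case, and this is
harmless because `p 0 > 0`: all symbols of a block are forced with positive probability
(`PastKernel.needProb_zero_pos`).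
-/

set_option linter.unusedSectionVars false

namespace InfiniteChain

/-! ### Partitions of an interval indexed by the alphabet -/

section Slots

variable {A : Type*} [Encodable A]

/-- The total weight of the symbols that are enumerated before `n`. -/
noncomputable def partialMass (d : A → ℝ) (n : ℕ) : ℝ :=
  ∑' b, if Encodable.encode b < n then d b else 0

/-- The interval of length `d a` that belongs to the symbol `a` when intervals of lengths `d b` are
placed side by side from `c` on, in the order of the enumeration. -/
def slot (c : ℝ) (d : A → ℝ) (a : A) : Set ℝ :=
  Set.Ico (c + partialMass d (Encodable.encode a)) (c + partialMass d (Encodable.encode a + 1))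

variable {d : A → ℝ}

lemma summable_partialMass (hd : ∀ a, 0 ≤ d a) (hs : Summable d) (n : ℕ) :
    Summable fun b => if Encodable.encode b < n then d b else 0 :=
  hs.of_nonneg_of_le (fun b => by split_ifs <;> simp [hd]) (fun b => by split_ifs <;> simp [hd])

lemma partialMass_mono (hd : ∀ a, 0 ≤ d a) (hs : Summable d) : Monotone (partialMass d) := by
  intro m n hmn
  refine (summable_partialMass hd hs m).tsum_le_tsum (fun b => ?_) (summable_partialMass hd hs n)
  by_cases h : Encodable.encode b < m
  · simp [h, h.trans_le hmn]
  · simp only [h, if_false]; split_ifs <;> simp [hd]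

lemma partialMass_le_tsum (hd : ∀ a, 0 ≤ d a) (hs : Summable d) (n : ℕ) :
    partialMass d n ≤ ∑' b, d b :=
  (summable_partialMass hd hs n).tsum_le_tsum (fun b => by split_ifs <;> simp [hd]) hs

@[simp] lemma partialMass_zero : partialMass d 0 = 0 := by simp [partialMass]

lemma partialMass_nonneg (hd : ∀ a, 0 ≤ d a) (n : ℕ) : 0 ≤ partialMass d n :=
  tsum_nonneg fun b => by split_ifs <;> simp [hd]

lemma partialMass_encode_succ (hd : ∀ a, 0 ≤ d a) (hs : Summable d) (a : A) :
    partialMass d (Encodable.encode a + 1) = partialMass d (Encodable.encode a) + d a := by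
  classical
  have h1 : HasSum (fun b => if b = a then d b else 0) (d a) := by
    convert hasSum_ite_eq a (d a) using 2 with b
    split_ifs with h <;> simp [h]
  have h2 := (summable_partialMass hd hs (Encodable.encode a)).hasSum.add h1
  rw [partialMass, partialMass, ← h2.tsum_eq]
  congr 1; ext b
  rcases lt_trichotomy (Encodable.encode b) (Encodable.encode a) with h | h | h
  · have : b ≠ a := fun e => by simp [e] at h
    simp [h, this, h.trans (Nat.lt_succ_self _)]
  · have : b = a := Encodable.encode_injective h
    simp [this]
  · have : b ≠ a := fun e => by simp [e] at h
    simp [this, not_lt.2 h.le, not_lt.2 (Nat.succ_le_of_lt h)]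

lemma partialMass_succ_of_not_exists (n : ℕ) (h : ¬ ∃ a : A, Encodable.encode a = n) :
    partialMass d (n + 1) = partialMass d n := by
  unfold partialMass
  congr 1; ext b
  have : Encodable.encode b ≠ n := fun e => h ⟨b, e⟩
  have : (Encodable.encode b < n + 1) = (Encodable.encode b < n) := by
    apply propext; omega
  simp [this]

lemma measurableSet_slot (c : ℝ) (d : A → ℝ) (a : A) : MeasurableSet (slot c d a) :=
  measurableSet_Ico

lemma volume_slot (hd : ∀ a, 0 ≤ d a) (hs : Summable d) (c : ℝ) (a : A) :
    volume (slot c d a) = ENNReal.ofReal (d a) := by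
  rw [slot, Real.volume_Ico, partialMass_encode_succ hd hs]
  congr 1; ring

lemma slot_subset (hd : ∀ a, 0 ≤ d a) (hs : Summable d) (c : ℝ) (a : A) :
    slot c d a ⊆ Set.Ico c (c + ∑' b, d b) := by
  intro t ht
  have h1 := partialMass_nonneg hd (Encodable.encode a)
  have h2 := partialMass_le_tsum hd hs (Encodable.encode a + 1)
  exact ⟨by linarith [ht.1], by linarith [ht.2]⟩

lemma slot_unique (hd : ∀ a, 0 ≤ d a) (hs : Summable d) {c t : ℝ} {a b : A}
    (ha : t ∈ slot c d a) (hb : t ∈ slot c d b) : a = b := by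
  by_contra hne
  have hne' : Encodable.encode a ≠ Encodable.encode b := fun e =>
    hne (Encodable.encode_injective e)
  rcases lt_or_gt_of_ne hne' with h | h
  · have := partialMass_mono hd hs (Nat.succ_le_of_lt h)
    have h1 := ha.2; have h2 := hb.1
    simp only [Nat.succ_eq_add_one] at this
    linarith
  · have := partialMass_mono hd hs (Nat.succ_le_of_lt h)
    have h1 := hb.2; have h2 := ha.1
    simp only [Nat.succ_eq_add_one] at this
    linarith

lemma exists_mem_slot (hd : ∀ a, 0 ≤ d a) (hs : Summable d) {c t : ℝ}
    (ht : t ∈ Set.Ico c (c + ∑' b, d b)) : ∃ a, t ∈ slot c d a := by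
  classical
  have hlt : t - c < ∑' b, d b := by linarith [ht.2]
  obtain ⟨F, hF⟩ : ∃ F : Finset A, t - c < ∑ b ∈ F, d b := by
    by_contra! hcon
    exact absurd (hs.tsum_le_of_sum_le hcon) (not_le.2 hlt)
  have hex : ∃ n, t - c < partialMass d n := by
    refine ⟨F.sup Encodable.encode + 1, hF.trans_le ?_⟩
    have : ∑ b ∈ F, d b
        = ∑ b ∈ F, if Encodable.encode b < F.sup Encodable.encode + 1 then d b else 0 := by
      refine Finset.sum_congr rfl fun b hb => ?_
      rw [if_pos (Nat.lt_succ_of_le (Finset.le_sup hb))]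
    rw [this]
    exact (summable_partialMass hd hs _).sum_le_tsum _
      fun b _ => by split_ifs <;> simp [hd]
  have hspec := Nat.find_spec hex
  obtain ⟨n, hn⟩ : ∃ n, Nat.find hex = n + 1 := by
    refine Nat.exists_eq_succ_of_ne_zero fun h0 => ?_
    rw [h0, partialMass_zero] at hspec
    linarith [ht.1]
  have hmin : partialMass d n ≤ t - c := not_lt.1 (Nat.find_min hex (by omega))
  rw [hn] at hspec
  by_cases h : ∃ a : A, Encodable.encode a = n
  · obtain ⟨a, rfl⟩ := h
    exact ⟨a, by constructor <;> linarith⟩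
  · rw [partialMass_succ_of_not_exists n h] at hspec
    linarith

end Slots

/-! ### Partitions of the unit interval in successive levels -/

section Levels

variable {A : Type*} [Encodable A]

/-- An increasing sequence of summable families of weights which starts from zero. -/
structure IsLevelFamily (b : ℕ → A → ℝ) : Prop where
  zero : ∀ a, b 0 a = 0
  mono : ∀ a, Monotone fun k => b k a
  summable : ∀ k, Summable (b k)

/-- The interval assigned to the symbol `a` by the increments between the levels `k` and `k + 1`:
the increments of level `k` occupy the interval from `∑ₐ b k a` to `∑ₐ b (k + 1) a`. -/
def levelSlot (b : ℕ → A → ℝ) (k : ℕ) (a : A) : Set ℝ :=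
  slot (∑' c, b k c) (fun c => b (k + 1) c - b k c) a

open Classical in
/-- The symbol whose intervals contain `t`. -/
noncomputable def selectSymbol [Nonempty A] (b : ℕ → A → ℝ) (t : ℝ) : A :=
  if h : ∃ a, ∃ k, t ∈ levelSlot b k a then h.choose else Classical.arbitrary A

namespace IsLevelFamily

variable {b : ℕ → A → ℝ}

lemma diff_nonneg (hb : IsLevelFamily b) (k : ℕ) (a : A) : 0 ≤ b (k + 1) a - b k a :=
  sub_nonneg.2 (hb.mono a k.le_succ)

lemma diff_summable (hb : IsLevelFamily b) (k : ℕ) : Summable fun a => b (k + 1) a - b k a :=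
  (hb.summable _).sub (hb.summable _)

lemma mass_mono (hb : IsLevelFamily b) : Monotone fun k => ∑' c, b k c := fun i j hij =>
  (hb.summable i).tsum_le_tsum (fun a => hb.mono a hij) (hb.summable j)

lemma levelSlot_subset (hb : IsLevelFamily b) (k : ℕ) (a : A) :
    levelSlot b k a ⊆ Set.Ico (∑' c, b k c) (∑' c, b (k + 1) c) := by
  have := slot_subset (hb.diff_nonneg k) (hb.diff_summable k) (∑' c, b k c) a
  rwa [(hb.summable (k + 1)).tsum_sub (hb.summable k), add_sub_cancel] at this

lemma level_unique (hb : IsLevelFamily b) {t : ℝ} {j k : ℕ} {a a' : A}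
    (h : t ∈ levelSlot b j a) (h' : t ∈ levelSlot b k a') : j = k := by
  have h1 := hb.levelSlot_subset j a h
  have h2 := hb.levelSlot_subset k a' h'
  by_contra hne
  rcases lt_or_gt_of_ne hne with hlt | hlt
  · have := hb.mass_mono (Nat.succ_le_of_lt hlt)
    simp only [Nat.succ_eq_add_one] at this
    linarith [h1.2, h2.1]
  · have := hb.mass_mono (Nat.succ_le_of_lt hlt)
    simp only [Nat.succ_eq_add_one] at this
    linarith [h2.2, h1.1]

lemma symbol_unique (hb : IsLevelFamily b) {t : ℝ} {j k : ℕ} {a a' : A}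
    (h : t ∈ levelSlot b j a) (h' : t ∈ levelSlot b k a') : a = a' := by
  obtain rfl := hb.level_unique h h'
  exact slot_unique (hb.diff_nonneg j) (hb.diff_summable j) h h'

lemma exists_mem_levelSlot (hb : IsLevelFamily b) {t : ℝ} (h0 : 0 ≤ t) {k : ℕ}
    (hk : t < ∑' c, b k c) : ∃ j < k, ∃ a, t ∈ levelSlot b j a := by
  induction k with
  | zero => simp [hb.zero] at hk; linarith
  | succ k ih =>
    rcases lt_or_ge t (∑' c, b k c) with h | h
    · obtain ⟨j, hj, a, ha⟩ := ih h
      exact ⟨j, hj.trans k.lt_succ_self, a, ha⟩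
    · obtain ⟨a, ha⟩ := exists_mem_slot (hb.diff_nonneg k) (hb.diff_summable k)
        (c := ∑' c, b k c) (t := t) (by
          rw [(hb.summable (k + 1)).tsum_sub (hb.summable k), add_sub_cancel]
          exact ⟨h, hk⟩)
      exact ⟨k, k.lt_succ_self, a, ha⟩

lemma selectSymbol_eq [Nonempty A] (hb : IsLevelFamily b) {t : ℝ} {k : ℕ} {a : A}
    (h : t ∈ levelSlot b k a) : selectSymbol b t = a := by
  have hex : ∃ a, ∃ k, t ∈ levelSlot b k a := ⟨a, k, h⟩
  rw [selectSymbol, dif_pos hex]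
  obtain ⟨j, hj⟩ := hex.choose_spec
  exact hb.symbol_unique hj h

lemma selectSymbol_congr [Nonempty A] (hb : IsLevelFamily b) {b' : ℕ → A → ℝ}
    (hb' : IsLevelFamily b') {t : ℝ} (h0 : 0 ≤ t) {k : ℕ} (hk : t < ∑' c, b k c)
    (heq : ∀ j ≤ k, b j = b' j) : selectSymbol b t = selectSymbol b' t := by
  obtain ⟨j, hj, a, ha⟩ := hb.exists_mem_levelSlot h0 hk
  rw [hb.selectSymbol_eq ha]
  refine (hb'.selectSymbol_eq (k := j) ?_).symm
  rwa [levelSlot, ← heq j hj.le, ← heq (j + 1) hj]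

lemma volume_iUnion_levelSlot (hb : IsLevelFamily b) {a : A} {p : ℝ}
    (hp : Tendsto (fun k => b k a) atTop (𝓝 p)) :
    volume (⋃ k, levelSlot b k a) = ENNReal.ofReal p := by
  have hsum : HasSum (fun k => b (k + 1) a - b k a) p := by
    rw [hasSum_iff_tendsto_nat_of_nonneg (fun k => hb.diff_nonneg k a)]
    simpa [Finset.sum_range_sub (fun k => b k a), hb.zero] using hp
  have hmeas : ∀ k, MeasurableSet (levelSlot b k a) := fun k => measurableSet_slot _ _ _
  rw [measure_iUnion (fun j k hjk => ?_) hmeas]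
  · simp_rw [levelSlot, volume_slot (hb.diff_nonneg _) (hb.diff_summable _)]
    rw [← ENNReal.ofReal_tsum_of_nonneg (fun k => hb.diff_nonneg k a) hsum.summable, hsum.tsum_eq]
  · exact Set.disjoint_left.2 fun t h h' => hjk (hb.level_unique h h')

/-- If the weights of the levels increase to a probability distribution `p`, then `selectSymbol`
turns a uniform variable into a symbol of law `p`. -/
lemma volume_selectSymbol [Nonempty A] (hb : IsLevelFamily b) {p : A → ℝ}
    (hp : ∀ a, Tendsto (fun k => b k a) atTop (𝓝 (p a))) (hle : ∀ k, ∑' c, b k c ≤ 1)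
    (hlim : ∀ t < 1, ∃ k, t < ∑' c, b k c) (a : A) :
    MeasurableSet {t : ℝ | t ∈ Set.Ico (0 : ℝ) 1 ∧ selectSymbol b t = a} ∧
      volume {t : ℝ | t ∈ Set.Ico (0 : ℝ) 1 ∧ selectSymbol b t = a} = ENNReal.ofReal (p a) := by
  have hset : {t : ℝ | t ∈ Set.Ico (0 : ℝ) 1 ∧ selectSymbol b t = a} = ⋃ k, levelSlot b k a := by
    ext t
    simp only [Set.mem_ofPred_eq, Set.mem_iUnion]
    constructor
    · rintro ⟨ht, hsel⟩
      obtain ⟨k, hk⟩ := hlim t ht.2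
      obtain ⟨j, -, a', ha'⟩ := hb.exists_mem_levelSlot ht.1 hk
      rw [hb.selectSymbol_eq ha'] at hsel
      exact ⟨j, hsel ▸ ha'⟩
    · rintro ⟨k, hk⟩
      refine ⟨?_, hb.selectSymbol_eq hk⟩
      have h1 := hb.levelSlot_subset k a hk
      have h2 := hb.mass_mono k.zero_le
      simp only [hb.zero, tsum_zero] at h2
      exact ⟨h2.trans h1.1, h1.2.trans_le (hle _)⟩
  rw [hset]
  exact ⟨MeasurableSet.iUnion fun k => measurableSet_slot _ _ _, hb.volume_iUnion_levelSlot (hp a)⟩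

end IsLevelFamily

end Levels

/-! ### Contexts and their concatenations -/

namespace PastString

variable {A : Type*}

lemma append_assoc (u v w : PastString A) : (u.append v).append w = u.append (v.append w) := by
  cases u <;> cases v <;> cases w <;> simp [append]

lemma complete_append (v w : PastString A) (z : Stream' A) :
    (v.append w).complete z = v.complete (w.complete z) := by
  cases v <;> cases w <;> simp [append, complete]

lemma foldl_append (u v : PastString A) (vs : List (PastString A)) :
    vs.foldl append (u.append v) = u.append (vs.foldl append v) := by
  induction vs generalizing v with
  | nil => rfl
  | cons w vs ih => rw [List.foldl_cons, List.foldl_cons, append_assoc, ih]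

lemma fin_isSuffix_inf {l : List A} {x : Stream' A} :
    (fin l).IsSuffix (inf x) ↔ l ++ₛ x.drop l.length = x := by
  constructor
  · rintro ⟨r, hr⟩
    cases r with
    | fin m => simp [append] at hr
    | inf s =>
      simp only [append, inf.injEq] at hr
      rw [hr, Stream'.drop_append_stream]
  · intro h
    exact ⟨inf (x.drop l.length), by simp [append, h]⟩

lemma inf_isSuffix_inf {s x : Stream' A} : (inf s).IsSuffix (inf x) ↔ s = x := by
  constructor
  · rintro ⟨r, hr⟩
    simpa [append, eq_comm] using hr
  · rintro rfl
    exact ⟨inf s, rfl⟩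

end PastString

lemma append_drop_eq_iff {A : Type*} {l : List A} {x : Stream' A} :
    l ++ₛ x.drop l.length = x ↔ ∀ i (h : i < l.length), x i = l[i] := by
  constructor
  · intro h i hi
    have := Stream'.get_append_left (n := i) l (x.drop l.length) hi
    rw [h] at this
    exact this
  · intro h
    refine Stream'.ext fun n => ?_
    rcases lt_or_ge n l.length with hn | hn
    · rw [Stream'.get_append_left _ _ _ hn]
      exact (h n hn).symm
    · obtain ⟨k, rfl⟩ := Nat.exists_eq_add_of_le hn
      rw [Stream'.get_append_right, Stream'.get_drop]

namespace ContextTree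

variable {A : Type*} (τ : ContextTree A)

lemma context_mem (x : Stream' A) : τ.context x ∈ τ.contexts := (τ.partition x).choose_spec.1.1

lemma context_isSuffix (x : Stream' A) : (τ.context x).IsSuffix (PastString.inf x) :=
  (τ.partition x).choose_spec.1.2

lemma context_eq {x : Stream' A} {v : PastString A} (hv : v ∈ τ.contexts)
    (hs : v.IsSuffix (PastString.inf x)) : τ.context x = v :=
  ((τ.partition x).choose_spec.2 v ⟨hv, hs⟩).symm

/-- A past which agrees with `x` on the context of `x` has the same context. -/
lemma context_congr {x y : Stream' A} {D : ℕ} (h : (τ.context x).length ≤ D)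
    (hxy : ∀ i < D, x i = y i) :
    τ.context y = τ.context x := by
  have hm := τ.context_mem x
  have hs := τ.context_isSuffix x
  cases hc : τ.context x with
  | inf s => simp [hc, PastString.length] at h
  | fin l =>
    rw [hc] at h hm hs
    refine τ.context_eq hm ?_
    rw [PastString.fin_isSuffix_inf, append_drop_eq_iff] at hs ⊢
    intro i hi
    rw [← hs i hi, hxy i]
    have : l.length ≤ D := by simpa [PastString.length] using h
    omega

/-- The past that remains when the context of `x` is removed from `x`. -/
noncomputable def rest (x : Stream' A) : Stream' A :=
  match τ.context x with
  | PastString.fin l => x.drop l.length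
  | PastString.inf _ => x

/-- The concatenation of the `k + 1` most recent consecutive contexts of `x`. -/
noncomputable def contextString : ℕ → Stream' A → PastString A
  | 0, x => τ.context x
  | k + 1, x => (τ.context x).append (contextString k (τ.rest x))

lemma complete_context_rest (x : Stream' A) : (τ.context x).complete (τ.rest x) = x := by
  have hs := τ.context_isSuffix x
  unfold rest
  cases hc : τ.context x with
  | fin l =>
    rw [hc] at hs
    exact PastString.fin_isSuffix_inf.1 hs
  | inf s =>
    rw [hc] at hs
    exact PastString.inf_isSuffix_inf.1 hs

lemma exists_complete_contextString (k : ℕ) (x : Stream' A) :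
    ∃ z, (τ.contextString k x).complete z = x := by
  induction k generalizing x with
  | zero => exact ⟨_, τ.complete_context_rest x⟩
  | succ k ih =>
    obtain ⟨z, hz⟩ := ih (τ.rest x)
    exact ⟨z, by rw [contextString, PastString.complete_append, hz, complete_context_rest]⟩

lemma exists_complete_contextString_succ (k : ℕ) (x z : Stream' A) :
    ∃ z', (τ.contextString (k + 1) x).complete z = (τ.contextString k x).complete z' := by
  induction k generalizing x with
  | zero => exact ⟨_, PastString.complete_append (τ.context x) (τ.context (τ.rest x)) z⟩
  | succ k ih =>
    obtain ⟨z', hz'⟩ := ih (τ.rest x)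
    refine ⟨z', ?_⟩
    rw [contextString, PastString.complete_append, hz', ← PastString.complete_append]
    rfl

lemma contextString_of_inf {x s : Stream' A} (h : τ.context x = PastString.inf s) (k : ℕ) :
    τ.contextString k x = PastString.inf x := by
  have hs := τ.context_isSuffix x
  rw [h, PastString.inf_isSuffix_inf] at hs
  subst hs
  cases k <;> simp [contextString, h, PastString.append]

lemma exists_concat_eq_contextString (k : ℕ) (x : Stream' A) :
    ∃ w : Fin k → τ.contexts, τ.contextString k x =
      (τ.context x).concat (List.ofFn fun i => (w i : PastString A)) := by
  have key : ∀ (k : ℕ) (x : Stream' A), ∃ vs : List (PastString A), vs.length = k ∧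
      (∀ v ∈ vs, v ∈ τ.contexts) ∧ τ.contextString k x = (τ.context x).concat vs := by
    intro k
    induction k with
    | zero => exact fun x => ⟨[], rfl, by simp, rfl⟩
    | succ k ih =>
      intro x
      obtain ⟨vs, hl, hm, he⟩ := ih (τ.rest x)
      refine ⟨τ.context (τ.rest x) :: vs, by simp [hl], ?_, ?_⟩
      · intro v hv
        rcases List.mem_cons.1 hv with rfl | hv
        · exact τ.context_mem _
        · exact hm v hv
      · rw [contextString, he, PastString.concat, PastString.concat, List.foldl_cons,
          PastString.foldl_append]
  obtain ⟨vs, rfl, hm, he⟩ := key k x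
  refine ⟨fun i => ⟨vs.get i, hm _ (List.get_mem _ _)⟩, ?_⟩
  rw [he]
  simp

end ContextTree

/-! ### The update function -/

namespace PastKernel

variable {A : Type*} (P : PastKernel A) (τ : ContextTree A)

lemma bddBelow_prob (a : A) {ι : Sort*} (f : ι → Stream' A) :
    BddBelow (Set.range fun i => P.prob a (f i)) :=
  ⟨0, by rintro _ ⟨i, rfl⟩; exact P.nonneg _ _⟩

lemma iInf_prob_nonneg (a : A) {ι : Sort*} (f : ι → Stream' A) : 0 ≤ ⨅ i, P.prob a (f i) :=
  Real.iInf_nonneg fun _ => P.nonneg _ _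

lemma alpha_nonneg (a : A) : 0 ≤ P.alpha a := P.iInf_prob_nonneg a fun z => z

lemma alpha_le (a : A) (x : Stream' A) : P.alpha a ≤ P.prob a x :=
  ciInf_le (P.bddBelow_prob a fun z => z) x

lemma summable_of_le_prob {f : A → ℝ} (x : Stream' A) (h0 : ∀ a, 0 ≤ f a)
    (h : ∀ a, f a ≤ P.prob a x) : Summable f :=
  (P.hasSum_one x).summable.of_nonneg_of_le h0 h

lemma summable_alpha [Nonempty A] : Summable P.alpha :=
  P.summable_of_le_prob (Stream'.const (Classical.arbitrary A)) P.alpha_nonneg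
    fun a => P.alpha_le a _

lemma alphaTotal_le_one [Nonempty A] : P.alphaTotal ≤ 1 := by
  have x := Stream'.const (Classical.arbitrary A)
  rw [← (P.hasSum_one x).tsum_eq]
  exact P.summable_alpha.tsum_le_tsum (fun a => P.alpha_le a x) (P.hasSum_one x).summable

lemma alphaTotal_nonneg : 0 ≤ P.alphaTotal := tsum_nonneg P.alpha_nonneg

/-- The weights of the symbols after the past `x`, in the order in which they are used by the update
function: the weight that `a` has after every past, and then, for `k = 0, 1, …`, the weight that it
has after every past ending with the `k + 1` most recent contexts of `x`. -/
noncomputable def levelWeight (x : Stream' A) : ℕ → A → ℝ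
  | 0, _ => 0
  | 1, a => P.alpha a
  | k + 2, a => ⨅ z, P.prob a ((τ.contextString k x).complete z)

lemma levelWeight_nonneg (x : Stream' A) (k : ℕ) (a : A) : 0 ≤ P.levelWeight τ x k a := by
  match k with
  | 0 => exact le_rfl
  | 1 => exact P.alpha_nonneg a
  | k + 2 => exact P.iInf_prob_nonneg a _

lemma levelWeight_le_prob (x : Stream' A) (k : ℕ) (a : A) :
    P.levelWeight τ x k a ≤ P.prob a x := by
  match k with
  | 0 => exact P.nonneg a x
  | 1 => exact P.alpha_le a x
  | k + 2 =>
    obtain ⟨z, hz⟩ := τ.exists_complete_contextString k x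
    refine (ciInf_le (P.bddBelow_prob a _) z).trans ?_
    simp only [hz]; exact le_rfl

lemma isLevelFamily_levelWeight [Nonempty A] (x : Stream' A) :
    IsLevelFamily (P.levelWeight τ x) where
  zero _ := rfl
  mono a := by
    have : Nonempty (Stream' A) := ⟨x⟩
    refine monotone_nat_of_le_succ fun k => ?_
    match k with
    | 0 => exact P.alpha_nonneg a
    | 1 => exact le_ciInf fun z => P.alpha_le a _
    | k + 2 =>
      refine le_ciInf fun z => ?_
      obtain ⟨z', hz'⟩ := τ.exists_complete_contextString_succ k x z
      rw [hz']
      exact ciInf_le (P.bddBelow_prob a _) z'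
  summable k := P.summable_of_le_prob x (P.levelWeight_nonneg τ x k) (P.levelWeight_le_prob τ x k)

lemma tsum_levelWeight_le_one [Nonempty A] (x : Stream' A) (k : ℕ) :
    ∑' a, P.levelWeight τ x k a ≤ 1 := by
  rw [← (P.hasSum_one x).tsum_eq]
  exact ((P.isLevelFamily_levelWeight τ x).summable k).tsum_le_tsum
    (P.levelWeight_le_prob τ x k) (P.hasSum_one x).summable

lemma bddBelow_extRate (k : ℕ) (v : PastString A) :
    BddBelow (Set.range fun w : Fin k → τ.contexts => ∑' a, ⨅ z : Stream' A,
      P.prob a ((v.concat (List.ofFn fun i => (w i : PastString A))).complete z)) :=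
  ⟨0, by rintro _ ⟨w, rfl⟩; exact tsum_nonneg fun a => P.iInf_prob_nonneg a _⟩

lemma extRate_nonneg (k : ℕ) (v : PastString A) : 0 ≤ P.extRate τ k v :=
  Real.iInf_nonneg fun _ => tsum_nonneg fun a => P.iInf_prob_nonneg a _

lemma extRate_le (k : ℕ) (x : Stream' A) :
    P.extRate τ k (τ.context x) ≤ ∑' a, P.levelWeight τ x (k + 2) a := by
  obtain ⟨w, hw⟩ := τ.exists_concat_eq_contextString k x
  refine (ciInf_le (P.bddBelow_extRate τ k _) w).trans_eq ?_
  simp only [← hw, levelWeight]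

lemma extRateLength_le {k : ℕ} {i : ℕ∞} {l : List A} (hl : PastString.fin l ∈ τ.contexts)
    (hi : (l.length : ℕ∞) ≤ i) : P.extRateLength τ k i ≤ P.extRate τ k (PastString.fin l) :=
  ciInf_le (f := fun l : {l : List A // PastString.fin l ∈ τ.contexts ∧ (l.length : ℕ∞) ≤ i} =>
    P.extRate τ k (PastString.fin l.1))
    ⟨0, by rintro _ ⟨_, rfl⟩; exact P.extRate_nonneg τ k _⟩ ⟨l, hl, hi⟩

lemma extRate_mono [Nonempty A] (v : PastString A) : Monotone fun k => P.extRate τ k v := by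
  have : Nonempty (Stream' A) := ⟨Stream'.const (Classical.arbitrary A)⟩
  have : Nonempty τ.contexts := ⟨⟨_, τ.context_mem (Classical.arbitrary _)⟩⟩
  refine monotone_nat_of_le_succ fun k => ?_
  refine le_ciInf fun w => ?_
  refine (ciInf_le (P.bddBelow_extRate τ k v) fun i => w i.castSucc).trans ?_
  have hsum : ∀ u : PastString A,
      Summable fun a => ⨅ z : Stream' A, P.prob a (u.complete z) := fun u =>
    P.summable_of_le_prob (u.complete (Classical.arbitrary _)) (fun a => P.iInf_prob_nonneg a _)
      fun a => ciInf_le (P.bddBelow_prob a _) _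
  refine (hsum _).tsum_le_tsum (fun a => ?_) (hsum _)
  refine le_ciInf fun z => ?_
  have : v.concat (List.ofFn fun i => (w i : PastString A)) =
      (v.concat (List.ofFn fun i : Fin k => (w i.castSucc : PastString A))).append
        (w (Fin.last k)) := by
    rw [PastString.concat, PastString.concat, List.ofFn_succ', List.concat_eq_append,
      List.foldl_append]
    rfl
  rw [this, PastString.complete_append]
  exact ciInf_le (P.bddBelow_prob a _) _

lemma extRateLength_mono [Nonempty A] (i : ℕ∞) : Monotone fun k => P.extRateLength τ k i := by
  intro j k hjk
  rcases isEmpty_or_nonempty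
    {l : List A // PastString.fin l ∈ τ.contexts ∧ (l.length : ℕ∞) ≤ i} with h | h
  · simp [extRateLength]
  · exact le_ciInf fun l => (P.extRateLength_le τ l.2.1 l.2.2).trans (P.extRate_mono τ _ hjk)

section Update

variable [Encodable A] [Nonempty A]

/-- The update function: it uses the smallest number of contexts of the past that determines the
new symbol. -/
noncomputable def update (x : Stream' A) (t : ℝ) : A := selectSymbol (P.levelWeight τ x) t

lemma forced_eq_some_iff {t : ℝ} {a : A} : P.forced t = some a ↔ t ∈ slot 0 P.alpha a := by
  have hmem : ∀ b : A,
      ((∑' c, if Encodable.encode c < Encodable.encode b then P.alpha c else 0) ≤ t ∧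
      t < ∑' c, if Encodable.encode c ≤ Encodable.encode b then P.alpha c else 0) ↔
        t ∈ slot 0 P.alpha b := by
    intro b
    simp only [slot, partialMass, Set.mem_Ico, zero_add, Nat.lt_succ_iff]
  unfold forced
  constructor
  · intro h
    split_ifs at h with hex
    rw [← Option.some.inj h]
    exact (hmem _).1 hex.choose_spec
  · intro h
    split_ifs with hex
    · congr 1
      exact slot_unique P.alpha_nonneg P.summable_alpha ((hmem _).1 hex.choose_spec) h
    · exact absurd ⟨a, (hmem a).2 h⟩ hex

lemma forced_ne_none_iff {t : ℝ} : P.forced t ≠ none ↔ t ∈ Set.Ico 0 P.alphaTotal := by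
  rw [Option.ne_none_iff_exists']
  simp only [forced_eq_some_iff]
  constructor
  · rintro ⟨a, ha⟩
    simpa [alphaTotal] using slot_subset P.alpha_nonneg P.summable_alpha 0 a ha
  · intro h
    exact exists_mem_slot P.alpha_nonneg P.summable_alpha (by simpa [alphaTotal] using h)

lemma update_eq_of_forced {x : Stream' A} {t : ℝ} {a : A} (h : P.forced t = some a) :
    P.update τ x t = a := by
  refine (P.isLevelFamily_levelWeight τ x).selectSymbol_eq (k := 0) ?_
  rw [forced_eq_some_iff] at h
  simpa [levelSlot, levelWeight] using h

/-- Below the threshold `ᾱ_k^v`, where `v` is the context of the past, the update function uses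
only the `k + 1` most recent contexts of the past. -/
lemma update_congr {x y : Stream' A} {t : ℝ} (h0 : 0 ≤ t) {k : ℕ}
    (ht : t < P.extRate τ k (τ.context x))
    (hxy : ∀ j ≤ k, τ.contextString j x = τ.contextString j y) :
    P.update τ x t = P.update τ y t := by
  refine (P.isLevelFamily_levelWeight τ x).selectSymbol_congr (P.isLevelFamily_levelWeight τ y) h0
    (ht.trans_le (P.extRate_le τ k x)) fun j hj => ?_
  match j, hj with
  | 0, _ => rfl
  | 1, _ => rfl
  | j + 2, hj =>
    ext a
    rw [levelWeight, levelWeight, hxy j (by omega)]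

lemma tendsto_tsum_levelWeight (hP : P.IsExtLC τ) (x : Stream' A) :
    Tendsto (fun k => ∑' a, P.levelWeight τ x k a) atTop (𝓝 1) := by
  rw [← tendsto_add_atTop_iff_nat 2]
  cases hc : τ.context x with
  | fin l =>
    have hm := τ.context_mem x
    rw [hc] at hm
    refine tendsto_of_tendsto_of_tendsto_of_le_of_le (hP l hm) tendsto_const_nhds (fun k => ?_)
      fun k => P.tsum_levelWeight_le_one τ x _
    have := P.extRate_le τ k x
    rwa [hc] at this
  | inf s =>
    have : Nonempty (Stream' A) := ⟨x⟩
    have : ∀ k, ∑' a, P.levelWeight τ x (k + 2) a = 1 := fun k => by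
      simp only [levelWeight, τ.contextString_of_inf hc, PastString.complete, ciInf_const,
        (P.hasSum_one x).tsum_eq]
    simp only [this]
    exact tendsto_const_nhds

lemma tendsto_levelWeight (hP : P.IsExtLC τ) (x : Stream' A) (a : A) :
    Tendsto (fun k => P.levelWeight τ x k a) atTop (𝓝 (P.prob a x)) := by
  have h1 : Tendsto (fun k => P.prob a x - (1 - ∑' a, P.levelWeight τ x k a)) atTop
      (𝓝 (P.prob a x)) := by
    simpa using ((P.tendsto_tsum_levelWeight τ hP x).const_sub 1).const_sub (P.prob a x)
  refine tendsto_of_tendsto_of_tendsto_of_le_of_le h1 tendsto_const_nhds (fun k => ?_)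
    fun k => P.levelWeight_le_prob τ x k a
  have hs := (P.isLevelFamily_levelWeight τ x).summable k
  have h2 := ((P.hasSum_one x).summable.sub hs).le_tsum a
    fun b _ => sub_nonneg.2 (P.levelWeight_le_prob τ x k b)
  rw [(P.hasSum_one x).summable.tsum_sub hs, (P.hasSum_one x).tsum_eq] at h2
  show P.prob a x - _ ≤ _
  linarith

lemma isUpdateFunction_update (hP : P.IsExtLC τ) : P.IsUpdateFunction (P.update τ) := fun x a =>
  (P.isLevelFamily_levelWeight τ x).volume_selectSymbol (P.tendsto_levelWeight τ hP x)
    (P.tsum_levelWeight_le_one τ x)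
    (fun _ ht => ((P.tendsto_tsum_levelWeight τ hP x).eventually (lt_mem_nhds ht)).exists) a

end Update

end PastKernel

/-! ### Blocks of a driving sequence -/

/-- The sequence `s` without its first `k` terms. Driving sequences are listed backward in time, so
this is the driving sequence seen `k` units of time earlier. -/
def shift {α : Type*} (k : ℕ) (s : ℕ → α) : ℕ → α := fun i => s (k + i)

@[simp] lemma shift_apply {α : Type*} (k : ℕ) (s : ℕ → α) (i : ℕ) : shift k s i = s (k + i) := rfl

@[simp] lemma shift_zero {α : Type*} (s : ℕ → α) : shift 0 s = s := by ext; simp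

lemma shift_shift {α : Type*} (j k : ℕ) (s : ℕ → α) : shift j (shift k s) = shift (k + j) s := by
  ext; simp [add_assoc]

namespace PastKernel

variable {A : Type*} [Encodable A] [Nonempty A] (P : PastKernel A) (τ : ContextTree A)

/-- The largest length of a context of a past whose symbols are those forced by `s`, wherever `s`
forces one. -/
noncomputable def backContext (s : ℕ → ℝ) : ℕ∞ :=
  ⨆ a : ℕ → A, (τ.context fun k => (P.forced (s k)).getD (a k)).length

/-- The `D` most recent symbols of `x` are those forced by `s`, wherever `s` forces one. -/
def Compatible (s : ℕ → ℝ) (D : ℕ) (x : Stream' A) : Prop :=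
  ∀ i < D, ∀ a, P.forced (s i) = some a → x i = a

lemma maxContextLength_eq (u : ℤ → ℝ) (n : ℤ) :
    P.maxContextLength τ u n = P.backContext τ fun k => u (n - k) := by
  unfold maxContextLength backContext filledPast
  refine le_antisymm (iSup_le fun a => ?_) (iSup_le fun a => ?_)
  · exact le_iSup (fun a : ℕ → A =>
      (τ.context fun k => (P.forced (u (n - k))).getD (a k)).length) fun k => a (n - k)
  · refine le_trans (le_of_eq ?_) (le_iSup (fun a : ℤ → A =>
      (τ.context fun k => (P.forced (u (n - k))).getD (a (n - k))).length)
        fun i => a (n - i).toNat)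
    simp

variable {P τ}

lemma length_context_le {s : ℕ → ℝ} {D : ℕ} (h : P.backContext τ s ≤ D) {x : Stream' A}
    (hx : P.Compatible s D x) : (τ.context x).length ≤ P.backContext τ s := by
  have h1 : (τ.context fun k => (P.forced (s k)).getD (x k)).length ≤ P.backContext τ s :=
    le_iSup (fun a : ℕ → A => (τ.context fun k => (P.forced (s k)).getD (a k)).length) x
  rw [τ.context_congr (y := x) (h1.trans h) fun i hi => ?_]
  · exact h1
  · cases hf : P.forced (s i) with
    | none => rfl
    | some a => exact (hx i hi a hf).symm

/-- If all contexts compatible with `s` have length at most `D`, then so have those compatible with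
`s'`, provided that `s'` agrees with `s` wherever `s` forces one of the `D` most recent symbols. -/
lemma backContext_le {s s' : ℕ → ℝ} {D : ℕ} (h : P.backContext τ s ≤ D)
    (hs : ∀ i < D, P.forced (s i) = none ∨ P.forced (s' i) = P.forced (s i)) :
    P.backContext τ s' ≤ P.backContext τ s := by
  refine iSup_le fun a => length_context_le h fun i hi b hb => ?_
  rcases hs i hi with h0 | h0
  · simp [h0] at hb
  · simp [h0, hb]

lemma backContext_eq {s s' : ℕ → ℝ} {D : ℕ} (h : P.backContext τ s ≤ D)
    (hs : ∀ i < D, P.forced (s' i) = P.forced (s i)) :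
    P.backContext τ s' = P.backContext τ s := by
  have h1 := backContext_le h fun i hi => Or.inr (hs i hi)
  exact le_antisymm h1 (backContext_le (h1.trans h) fun i hi => Or.inr (hs i hi).symm)

variable (P τ)

/-- The first `k` terms of `s` form a window which starts (in time) with a forced symbol and which,
at each of its times, contains the contexts of the past. Thus `-k + 1` is a good coalescence time
for time `0`. -/
def IsBlock (s : ℕ → ℝ) (k : ℕ) : Prop :=
  1 ≤ k ∧ P.forced (s (k - 1)) ≠ none ∧ ∀ j < k, P.backContext τ (shift j s) ≤ ((k - j : ℕ) : ℕ∞)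

/-- The length of the shortest block at the beginning of `s`, and `0` if there is none. -/
noncomputable def blockLength (s : ℕ → ℝ) : ℕ := sInf {k | P.IsBlock τ s k}

/-- The driving sequence that precedes the first block. -/
noncomputable def dropBlock (s : ℕ → ℝ) : ℕ → ℝ := shift (P.blockLength τ s) s

/-- At each time of the first block the symbol is forced, or the driving variable is below the
threshold under which `k` contexts beyond the most recent one suffice. -/
def NeedsAtMost (k : ℕ) (s : ℕ → ℝ) : Prop :=
  ∀ j < P.blockLength τ s, P.forced (s j) ≠ none ∨
    s j < P.extRateLength τ k (P.backContext τ (shift (j + 1) s))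

/-- `m` is a renewal: the symbols in each of the first `m` blocks are determined by these blocks. -/
def IsRenewal : ℕ → (ℕ → ℝ) → Prop
  | 0, _ => True
  | m + 1, s => P.NeedsAtMost τ m s ∧ IsRenewal m (P.dropBlock τ s)

/-- The total length of the first `m` blocks. -/
noncomputable def totalLength : ℕ → (ℕ → ℝ) → ℕ
  | 0, _ => 0
  | m + 1, s => P.blockLength τ s + totalLength m (P.dropBlock τ s)

/-- Blocks start everywhere in the sequence `s`. -/
def HasBlocks (s : ℕ → ℝ) : Prop := ∀ n, ∃ k, P.IsBlock τ (shift n s) k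

variable {P τ}

lemma HasBlocks.shift {s : ℕ → ℝ} (h : P.HasBlocks τ s) (n : ℕ) :
    P.HasBlocks τ (shift n s) := fun m => by
  rw [shift_shift]; exact h _

lemma HasBlocks.isBlock {s : ℕ → ℝ} (h : P.HasBlocks τ s) :
    P.IsBlock τ s (P.blockLength τ s) := by
  have := h 0
  rw [shift_zero] at this
  exact Nat.sInf_mem this

/-- Two pasts that agree on a window of `d > 0` times, which contains the contexts that start in it,
and on the `r` blocks before the window, have the same `r + 1` most recent contexts, since each of
the blocks contains at least one of them. -/
lemma contextString_congr {q d r : ℕ} {s : ℕ → ℝ} (hs : P.HasBlocks τ s) (hd : 0 < d)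
    (hw : ∀ j < d, P.backContext τ (shift j s) ≤ ((d - j : ℕ) : ℕ∞)) (hq : q ≤ r)
    {x y : Stream' A} {D : ℕ} (hD : D = d + P.totalLength τ r (shift d s))
    (hx : P.Compatible s D x) (hxy : ∀ i < D, x i = y i) :
    τ.contextString q x = τ.contextString q y := by
  have hb : P.backContext τ s ≤ (d : ℕ∞) := by simpa using hw 0 hd
  have hl := (length_context_le hb fun i hi => hx i (by omega)).trans hb
  have hc : τ.context y = τ.context x := τ.context_congr hl fun i hi => hxy i (by omega)
  induction q generalizing d r s x y D with
  | zero => exact hc.symm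
  | succ q ih =>
    rw [ContextTree.contextString, ContextTree.contextString, hc]
    congr 1
    have hm := τ.context_mem x
    cases hcx : τ.context x with
    | inf t => simp [hcx, PastString.length] at hl
    | fin l =>
      rw [hcx] at hl hc
      have hld : l.length ≤ d := by simpa [PastString.length] using hl
      have hrx : τ.rest x = x.drop l.length := by simp [ContextTree.rest, hcx]
      have hry : τ.rest y = y.drop l.length := by simp [ContextTree.rest, hc]
      rw [hrx, hry]
      have hget : ∀ (z : Stream' A) i, (z.drop l.length) i = z (l.length + i) := fun z i => by
        show z (i + l.length) = _
        rw [add_comm]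
      -- The remaining position is in the same window, or at the beginning of an older block.
      obtain ⟨d', r', hd', hqr, hw', hD'⟩ : ∃ d' r', 0 < d' ∧ q ≤ r' ∧
          (∀ j < d', P.backContext τ (InfiniteChain.shift j (InfiniteChain.shift l.length s))
            ≤ ((d' - j : ℕ) : ℕ∞)) ∧
          D - l.length = d' + P.totalLength τ r'
            (InfiniteChain.shift d' (InfiniteChain.shift l.length s)) := by
        rcases hld.lt_or_eq with hlt | heq
        · refine ⟨d - l.length, r, by omega, by omega, fun j hj => ?_, ?_⟩
          · rw [shift_shift, Nat.sub_sub]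
            exact hw (l.length + j) (by omega)
          · rw [shift_shift, Nat.add_sub_cancel' hld]
            omega
        · obtain ⟨r, rfl⟩ : ∃ r', r = r' + 1 := ⟨r - 1, by omega⟩
          have hB := (hs.shift l.length).isBlock
          refine ⟨_, r, hB.1, by omega, hB.2.2, ?_⟩
          rw [hD, heq, totalLength]
          simp only [dropBlock]
          omega
      have hxc : P.Compatible (InfiniteChain.shift l.length s) (D - l.length)
          (x.drop l.length) := fun i hi a ha => by
        rw [hget]; exact hx _ (by omega) a ha
      have hb' : P.backContext τ (InfiniteChain.shift l.length s) ≤ (d' : ℕ∞) := by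
        simpa using hw' 0 hd'
      have hxy' : ∀ i < D - l.length, (x.drop l.length) i = (y.drop l.length) i := fun i hi => by
        rw [hget, hget]; exact hxy _ (by omega)
      have hl' := (length_context_le hb' fun i hi => hxc i (by omega)).trans hb'
      exact ih (hs.shift _) hd' hw' hqr hD' hxc hxy' hb' hl'
        (τ.context_congr hl' fun i hi => hxy' i (by omega))

end PastKernel

/-! ### Coalescence -/

section Coalescence

variable {A : Type*}

/-- The past at the end of the first `D` terms of the driving sequence `s`, when the past before
them is `x`. -/
def evolve (F : Stream' A → ℝ → A) (x : Stream' A) : ℕ → (ℕ → ℝ) → Stream' A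
  | 0, _ => x
  | D + 1, s => Stream'.cons (F (evolve F x D (shift 1 s)) (s 0)) (evolve F x D (shift 1 s))

/-- The driving sequence at time `m`, listed backward in time. -/
def backward (u : ℤ → ℝ) (m : ℤ) : ℕ → ℝ := fun n => u (m - n)

lemma shift_backward (u : ℤ → ℝ) (m : ℤ) (k : ℕ) :
    shift k (backward u m) = backward u (m - k) := by
  ext n
  simp [backward, sub_sub]

lemma iteratedPast_eq_evolve (F : Stream' A → ℝ → A) (u : ℤ → ℝ) (j : ℤ) (x : Stream' A) (D : ℕ) :
    iteratedPast F u j x D = evolve F x D (backward u (j + D - 1)) := by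
  induction D with
  | zero => rfl
  | succ D ih =>
    have h1 : shift 1 (backward u (j + ((D + 1 : ℕ) : ℤ) - 1)) = backward u (j + D - 1) := by
      rw [shift_backward]; congr 1; push_cast; ring
    have h2 : backward u (j + ((D + 1 : ℕ) : ℤ) - 1) 0 = u (j + D) := by
      simp only [backward]; congr 1; push_cast; ring
    rw [iteratedPast, evolve, ih, h1, h2]

/-- The `D` symbols constructed with the first `D` terms of `s` do not depend on the past. -/
def Forgets (F : Stream' A → ℝ → A) (D : ℕ) (s : ℕ → ℝ) : Prop :=
  ∀ x y : Stream' A, ∀ i < D, evolve F x D s i = evolve F y D s i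

lemma coalescenceLag_lt_of_forgets {F : Stream' A → ℝ → A} {u : ℤ → ℝ} {m : ℤ} {D : ℕ}
    (hD : 0 < D) (h : Forgets F D (backward u m)) : coalescenceLag F u m m < D := by
  obtain ⟨k, rfl⟩ : ∃ k, D = k + 1 := ⟨D - 1, by omega⟩
  have hc : Coalesces F u m m (m - k) := by
    intro t h1 h2 x y
    obtain rfl : t = k := by omega
    have := h x y 0 (by omega)
    have e : m = (m - t) + ((t + 1 : ℕ) : ℤ) - 1 := by push_cast; ring
    rw [e, ← iteratedPast_eq_evolve, ← iteratedPast_eq_evolve] at this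
    exact this
  refine lt_of_le_of_lt (iInf₂_le k hc) ?_
  exact_mod_cast Nat.lt_succ_self k

lemma iteratedPast_add (F : Stream' A → ℝ → A) (u : ℤ → ℝ) (j : ℤ) (x : Stream' A) (k n : ℕ) :
    iteratedPast F u j x (k + n) = iteratedPast F u (j + k) (iteratedPast F u j x k) n := by
  induction n with
  | zero => rfl
  | succ n ih =>
    rw [← add_assoc, iteratedPast, iteratedPast, ih]
    congr 3
    push_cast; ring

/-- A window coalesces as soon as each of its times does. -/
lemma coalescenceLag_lt_top {F : Stream' A → ℝ → A} {u : ℤ → ℝ}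
    (h : ∀ k : ℤ, coalescenceLag F u k k < ⊤) (m n : ℤ) : coalescenceLag F u m n < ⊤ := by
  have hc : ∀ i : ℤ, ∃ k : ℕ, Coalesces F u i i (i - k) := by
    intro i
    by_contra! hcon
    have := h i
    simp [coalescenceLag, hcon] at this
  choose K hK using hc
  obtain ⟨N, hN⟩ : ∃ N : ℕ, ∀ i ∈ Finset.Icc m n, K i ≤ N :=
    ⟨(Finset.Icc m n).sup K, fun i hi => Finset.le_sup hi⟩
  refine lt_of_le_of_lt (iInf₂_le N ?_) (WithTop.coe_lt_top N)
  intro t h1 h2 x y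
  have hle := hN (m - N + t) (Finset.mem_Icc.2 ⟨h1, h2⟩)
  set i := m - N + t with hi
  -- Split the time `t` at the time from which the symbol at time `i` coalesces.
  obtain ⟨p, hp⟩ : ∃ p : ℕ, t = p + K i := ⟨t - K i, by omega⟩
  have hpos : m - (N : ℤ) + p = i - K i := by omega
  have key : ∀ x, iteratedUpdate F u (m - N) x t =
      iteratedUpdate F u (i - K i) (iteratedPast F u (m - N) x p) (K i) := by
    intro x
    rw [iteratedUpdate, iteratedUpdate, hp, iteratedPast_add, hpos]
    congr 2
    rw [← hpos]; push_cast; ring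
  rw [key, key]
  exact hK i (K i) (by omega) (by omega) _ _

end Coalescence

namespace PastKernel

variable {A : Type*} [Encodable A] [Nonempty A] {P : PastKernel A} {τ : ContextTree A}

lemma compatible_evolve (x : Stream' A) (D : ℕ) (s : ℕ → ℝ) :
    P.Compatible s D (evolve (P.update τ) x D s) := by
  induction D generalizing s with
  | zero => intro i hi; omega
  | succ D ih =>
    intro i hi a ha
    cases i with
    | zero => exact P.update_eq_of_forced τ ha
    | succ i => exact ih (shift 1 s) i (by omega) a (by rwa [shift_apply, add_comm])

/-- If `m` is a renewal, then the construction from the beginning (in time) of the `m`-th block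
does not depend on the past. -/
lemma forgets_of_isRenewal {m : ℕ} {s : ℕ → ℝ} (h0 : ∀ n, 0 ≤ s n) (hs : P.HasBlocks τ s)
    (hm : P.IsRenewal τ m s) : Forgets (P.update τ) (P.totalLength τ m s) s := by
  induction m generalizing s with
  | zero => intro x y i hi; simp [totalLength] at hi
  | succ m ih =>
    have hB := hs.isBlock
    set ℓ := P.blockLength τ s with hℓ
    set T := P.totalLength τ m (P.dropBlock τ s) with hT
    have hIH : Forgets (P.update τ) T (shift ℓ s) :=
      ih (fun n => h0 _) (hs.shift _) hm.2
    -- Go through the first block, from its beginning (in time) to its end.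
    have key : ∀ d ≤ ℓ, Forgets (P.update τ) (d + T) (shift (ℓ - d) s) := by
      intro d
      induction d with
      | zero => intro _; simpa using hIH
      | succ d ihd =>
        intro hd x y
        have hsh : shift 1 (shift (ℓ - (d + 1)) s) = shift (ℓ - d) s := by
          rw [shift_shift]; congr 1; omega
        have hprev := ihd (by omega) x y
        have hhead : P.update τ (evolve (P.update τ) x (d + T) (shift (ℓ - d) s))
              (s (ℓ - (d + 1))) =
            P.update τ (evolve (P.update τ) y (d + T) (shift (ℓ - d) s)) (s (ℓ - (d + 1))) := by
          cases hf : P.forced (s (ℓ - (d + 1))) with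
          | some a => rw [P.update_eq_of_forced τ hf, P.update_eq_of_forced τ hf]
          | none =>
            have hd0 : 0 < d := by
              rcases Nat.eq_zero_or_pos d with rfl | h
              · exact absurd hf hB.2.1
              · exact h
            have hw : ∀ j < d, P.backContext τ (shift j (shift (ℓ - d) s))
                ≤ ((d - j : ℕ) : ℕ∞) := fun j hj => by
              rw [shift_shift]
              convert hB.2.2 (ℓ - d + j) (by omega) using 2
              omega
            have hsl : shift d (shift (ℓ - d) s) = P.dropBlock τ s := by
              rw [shift_shift, Nat.sub_add_cancel (by omega)]; rfl
            have hcomp := compatible_evolve (P := P) (τ := τ) x (d + T) (shift (ℓ - d) s)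
            have hneed := (hm.1 (ℓ - (d + 1)) (by omega)).resolve_left (by simp [hf])
            have e : ℓ - (d + 1) + 1 = ℓ - d := by omega
            rw [e] at hneed
            have hb : P.backContext τ (shift (ℓ - d) s) ≤ (d : ℕ∞) := by
              have := hw 0 hd0
              rwa [shift_zero, Nat.sub_zero] at this
            have hl := length_context_le hb fun i hi => hcomp i (by omega)
            refine P.update_congr τ (h0 _) (k := m) (hneed.trans_le ?_) fun j hj =>
              contextString_congr (hs.shift _) hd0 hw hj (by rw [hsl]) hcomp hprev
            have hmem := τ.context_mem (evolve (P.update τ) x (d + T) (shift (ℓ - d) s))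
            cases hc : τ.context (evolve (P.update τ) x (d + T) (shift (ℓ - d) s)) with
            | inf t =>
              have := hl.trans hb
              simp [hc, PastString.length] at this
            | fin l =>
              rw [hc] at hmem hl
              exact P.extRateLength_le τ hmem hl
        intro i hi
        rw [show d + 1 + T = (d + T) + 1 by ring]
        simp only [evolve, hsh, shift_apply, Nat.add_zero]
        cases i with
        | zero => exact hhead
        | succ i => exact hprev i (by omega)
    have := key ℓ le_rfl
    rwa [Nat.sub_self, shift_zero] at this

end PastKernel

/-! ### The law of the driving sequence -/

section Drive

/-- The law of the driving sequence, listed backward in time: i.i.d. uniform variables. -/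
noncomputable def driveLaw : Measure (ℕ → ℝ) :=
  Measure.infinitePi fun _ => volume.restrict (Set.Ico (0 : ℝ) 1)

instance : IsProbabilityMeasure (volume.restrict (Set.Ico (0 : ℝ) 1)) := ⟨by simp⟩

instance : IsProbabilityMeasure driveLaw := by unfold driveLaw; infer_instance

lemma measurable_shift (k : ℕ) : Measurable (shift k : (ℕ → ℝ) → ℕ → ℝ) :=
  measurable_pi_lambda _ fun _ => measurable_pi_apply _

lemma map_shift_driveLaw (k : ℕ) : driveLaw.map (shift k) = driveLaw :=
  Measure.map_infinitePi_infinitePi_of_inj (P := fun _ : ℕ => volume.restrict (Set.Ico (0 : ℝ) 1))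
    (add_right_injective k)

lemma driveLaw_preimage_shift (k : ℕ) {C : Set (ℕ → ℝ)} (hC : MeasurableSet C) :
    driveLaw (shift k ⁻¹' C) = driveLaw C := by
  rw [← Measure.map_apply (measurable_shift k) hC, map_shift_driveLaw]

/-- Membership in `E` is decided by the first `k` terms of a sequence. -/
def DependsOnFirst (k : ℕ) (E : Set (ℕ → ℝ)) : Prop :=
  ∀ s s' : ℕ → ℝ, (∀ i < k, s i = s' i) → s ∈ E → s' ∈ E

lemma driveLaw_inter_preimage_shift {k : ℕ} {E C : Set (ℕ → ℝ)} (hE : MeasurableSet E)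
    (hEk : DependsOnFirst k E) (hC : MeasurableSet C) :
    driveLaw (E ∩ shift k ⁻¹' C) = driveLaw E * driveLaw C := by
  have hind : iIndepFun (fun (i : ℕ) (s : ℕ → ℝ) => s i) driveLaw :=
    iIndepFun_infinitePi (X := fun _ (t : ℝ) => t) fun _ => measurable_id
  have h := indep_iSup_of_disjoint
    (m := fun i : ℕ => MeasurableSpace.comap (fun s : ℕ → ℝ => s i) inferInstance)
    (fun i => (measurable_pi_apply i).comap_le) hind
    (S := Set.Iio k) (T := Set.Ici k) (Set.Iio_disjoint_Ici le_rfl)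
  rw [← driveLaw_preimage_shift k hC]
  refine (Indep_iff _ _ _).1 h _ _ ?_ ?_
  · -- `E` is the preimage of itself under truncation.
    have hEq : E = (fun (s : ℕ → ℝ) (i : ℕ) => if i < k then s i else 0) ⁻¹' E := by
      ext s
      exact ⟨hEk _ _ fun i hi => by simp [hi], hEk _ _ fun i hi => by simp [hi]⟩
    rw [hEq]
    refine (@measurable_pi_iff _ _ _ (_) _ _).2 (fun i => ?_) hE
    by_cases hi : i < k
    · simp only [hi, if_true]
      exact Measurable.mono (comap_measurable fun s : ℕ → ℝ => s i)
        (le_iSup₂ (f := fun (i : ℕ) (_ : i ∈ Set.Iio k) =>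
          MeasurableSpace.comap (fun s : ℕ → ℝ => s i) inferInstance) i hi) le_rfl
    · simp only [hi, if_false]
      exact measurable_const
  · refine (@measurable_pi_iff _ _ _ (_) _ _).2 (fun i => ?_) hC
    exact Measurable.mono (comap_measurable fun s : ℕ → ℝ => s (k + i))
        (le_iSup₂ (f := fun (i : ℕ) (_ : i ∈ Set.Ici k) =>
          MeasurableSpace.comap (fun s : ℕ → ℝ => s i) inferInstance) (k + i)
          (Set.mem_Ici.2 (by omega))) le_rfl

lemma ae_driveLaw_mem_Ico : ∀ᵐ s ∂driveLaw, ∀ n, s n ∈ Set.Ico (0 : ℝ) 1 := by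
  rw [ae_all_iff]
  intro n
  have h : driveLaw.map (fun s => s n) = volume.restrict (Set.Ico (0 : ℝ) 1) :=
    Measure.infinitePi_map_eval (fun _ : ℕ => volume.restrict (Set.Ico (0 : ℝ) 1)) n
  refine ae_of_ae_map (f := fun s : ℕ → ℝ => s n) (p := fun t => t ∈ Set.Ico (0 : ℝ) 1)
    (measurable_pi_apply n).aemeasurable ?_
  rw [h]
  exact ae_restrict_mem measurableSet_Ico

/-- At each time, the driving sequence of the past has the law `driveLaw`. -/
lemma map_backward_eq {Ω : Type*} [MeasurableSpace Ω] {μ : Measure Ω} [IsProbabilityMeasure μ]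
    {U : ℤ → Ω → ℝ} (hU : IsIIDUniform μ U) (m : ℤ) :
    μ.map (fun ω => backward (fun i => U i ω) m) = driveLaw := by
  have hinj : Function.Injective fun n : ℕ => m - (n : ℤ) := fun a b h => by
    simp only [sub_right_inj, Nat.cast_inj] at h; exact h
  have h := (iIndepFun_iff_map_fun_eq_infinitePi_map (X := fun n : ℕ => U (m - n))
    (fun n => hU.1 _)).1 (hU.2.1.precomp hinj)
  simp only [hU.2.2] at h
  exact h

lemma measurable_backward {Ω : Type*} [MeasurableSpace Ω] {U : ℤ → Ω → ℝ}
    (hU : ∀ i, Measurable (U i)) (m : ℤ) :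
    Measurable fun ω => backward (fun i => U i ω) m :=
  measurable_pi_lambda _ fun _ => hU _

end Drive

lemma measurable_of_nat {α β : Type*} [MeasurableSpace α] [MeasurableSpace β] {g : α → ℕ}
    (hg : Measurable g) {f : ℕ → α → β} (hf : ∀ n, Measurable (f n)) :
    Measurable fun a => f (g a) a :=
  (measurable_from_prod_countable_right (f := fun p : ℕ × α => f p.1 p.2) hf).comp
    (hg.prodMk measurable_id)

lemma measure_eq_tsum_fiber {α : Type*} [MeasurableSpace α] (μ : Measure α) {g : α → ℕ}
    (hg : Measurable g) (E : Set α) : μ E = ∑' n, μ (E ∩ g ⁻¹' {n}) := by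
  have h := tsum_measure_preimage_singleton (μ := μ.restrict E) (f := g) (s := Set.univ)
    Set.countable_univ fun n _ => hg (measurableSet_singleton n)
  rw [Set.preimage_univ, Measure.restrict_apply_univ, tsum_univ fun n =>
    (μ.restrict E) (g ⁻¹' {n})] at h
  rw [← h]
  congr 1; ext n
  rw [Measure.restrict_apply (hg (measurableSet_singleton n)), Set.inter_comm]

namespace PastKernel

variable {A : Type*} [Encodable A] [Nonempty A] (P : PastKernel A) (τ : ContextTree A)

/-! ### Measurability of the blocks -/

lemma measurableSet_forced_eq (o : Option A) : MeasurableSet {t | P.forced t = o} := by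
  cases o with
  | some a =>
    simp only [forced_eq_some_iff]
    exact measurableSet_slot _ _ _
  | none =>
    have : {t | P.forced t = none} = (Set.Ico 0 P.alphaTotal)ᶜ := by
      ext t
      rw [Set.mem_compl_iff, ← P.forced_ne_none_iff, not_not]
      rfl
    rw [this]
    exact measurableSet_Ico.compl

lemma measurableSet_forced_apply (o : Option A) (i : ℕ) :
    MeasurableSet {s : ℕ → ℝ | P.forced (s i) = o} :=
  (P.measurableSet_forced_eq o).preimage (measurable_pi_apply i)

/-- A set of driving sequences that is decided by the first `D` forced symbols is measurable. -/
lemma measurableSet_of_forced (D : ℕ) {E : Set (ℕ → ℝ)}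
    (hE : ∀ s s' : ℕ → ℝ, (∀ i < D, P.forced (s' i) = P.forced (s i)) → s ∈ E → s' ∈ E) :
    MeasurableSet E := by
  have hEq : E = ⋃ o ∈ {o : Fin D → Option A | ∃ s ∈ E, ∀ i : Fin D, P.forced (s i) = o i},
      ⋂ i : Fin D, {s : ℕ → ℝ | P.forced (s i) = o i} := by
    ext s
    simp only [Set.mem_iUnion, Set.mem_iInter, Set.mem_ofPred_eq, exists_prop]
    constructor
    · exact fun hs => ⟨fun i => P.forced (s i), ⟨s, hs, fun _ => rfl⟩, fun _ => rfl⟩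
    · rintro ⟨o, ⟨s', hs', ho'⟩, ho⟩
      exact hE s' s (fun i hi => (ho ⟨i, hi⟩).trans (ho' ⟨i, hi⟩).symm) hs'
  rw [hEq]
  exact MeasurableSet.biUnion (Set.to_countable _) fun o _ =>
    MeasurableSet.iInter fun i => P.measurableSet_forced_apply _ _

lemma measurable_backContext : Measurable (P.backContext τ) := by
  rw [ENat.measurable_iff]
  intro n
  refine P.measurableSet_of_forced n fun s s' h hs => ?_
  simp only [Set.mem_preimage, Set.mem_singleton_iff] at hs ⊢
  rw [backContext_eq hs.le h, hs]

variable {P τ}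

/-- A block remains a block when free symbols become forced. -/
lemma IsBlock.mono {s s' : ℕ → ℝ} {k : ℕ} (h : P.IsBlock τ s k)
    (hs : ∀ i < k, P.forced (s i) = none ∨ P.forced (s' i) = P.forced (s i)) :
    P.IsBlock τ s' k := by
  refine ⟨h.1, ?_, fun j hj => ?_⟩
  · rw [(hs (k - 1) (by have := h.1; omega)).resolve_left h.2.1]
    exact h.2.1
  · exact (backContext_le (h.2.2 j hj) fun i hi => hs (j + i) (by omega)).trans (h.2.2 j hj)

lemma isBlock_congr {s s' : ℕ → ℝ} {k : ℕ} (hs : ∀ i < k, P.forced (s' i) = P.forced (s i)) :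
    P.IsBlock τ s k ↔ P.IsBlock τ s' k :=
  ⟨fun h => h.mono fun i hi => Or.inr (hs i hi), fun h => h.mono fun i hi => Or.inr (hs i hi).symm⟩

lemma isBlock_blockLength {s : ℕ → ℝ} (h : 1 ≤ P.blockLength τ s) :
    P.IsBlock τ s (P.blockLength τ s) :=
  Nat.sInf_mem (Nat.nonempty_of_pos_sInf h)

lemma blockLength_congr {s s' : ℕ → ℝ} (h1 : 1 ≤ P.blockLength τ s)
    (hs : ∀ i < P.blockLength τ s, P.forced (s' i) = P.forced (s i)) :
    P.blockLength τ s' = P.blockLength τ s := by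
  have hB : P.IsBlock τ s' (P.blockLength τ s) := (isBlock_congr hs).1 (isBlock_blockLength h1)
  refine le_antisymm (Nat.sInf_le hB) (le_csInf ⟨_, hB⟩ fun k hk => ?_)
  by_contra! hlt
  exact absurd (Nat.sInf_le ((isBlock_congr fun i hi => hs i (hi.trans hlt)).2 hk))
    (not_le.2 hlt)

variable (P τ)

lemma measurableSet_isBlock (k : ℕ) : MeasurableSet {s | P.IsBlock τ s k} :=
  P.measurableSet_of_forced k fun _ _ h hs => (isBlock_congr h).1 hs

lemma measurable_blockLength : Measurable (P.blockLength τ) := by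
  refine measurable_to_countable' fun k => ?_
  rcases Nat.eq_zero_or_pos k with rfl | hk
  · have : P.blockLength τ ⁻¹' {0} = ⋂ k, {s | P.IsBlock τ s k}ᶜ := by
      ext s
      simp only [Set.mem_preimage, Set.mem_singleton_iff, Set.mem_iInter, Set.mem_compl_iff,
        Set.mem_ofPred_eq]
      constructor
      · intro h k hk
        rcases Nat.sInf_eq_zero.1 h with h0 | h0
        · exact absurd h0.1 (by omega)
        · exact (Set.mem_empty_iff_false k).1 (h0 ▸ hk)
      · intro h
        exact Nat.sInf_eq_zero.2 (Or.inr (Set.eq_empty_of_forall_notMem h))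
    rw [this]
    exact MeasurableSet.iInter fun k => (P.measurableSet_isBlock τ k).compl
  · refine P.measurableSet_of_forced k fun s s' h hs => ?_
    simp only [Set.mem_preimage, Set.mem_singleton_iff] at hs ⊢
    subst hs
    exact blockLength_congr hk h

lemma measurable_dropBlock : Measurable (P.dropBlock τ) :=
  measurable_of_nat (P.measurable_blockLength τ) measurable_shift

lemma measurableSet_lt_extRateLength (k j : ℕ) :
    MeasurableSet {s : ℕ → ℝ | s j < P.extRateLength τ k (P.backContext τ (shift (j + 1) s))} :=
  measurableSet_lt (measurable_pi_apply j)
    ((measurable_of_countable fun i : ℕ∞ => P.extRateLength τ k i).comp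
      ((P.measurable_backContext τ).comp (measurable_shift (j + 1))))

lemma measurableSet_needsAtMost (k : ℕ) : MeasurableSet {s | P.NeedsAtMost τ k s} := by
  have : {s | P.NeedsAtMost τ k s} = ⋂ j, ({s | j < P.blockLength τ s}ᶜ ∪
      ({s | P.forced (s j) = none}ᶜ ∪
        {s | s j < P.extRateLength τ k (P.backContext τ (shift (j + 1) s))})) := by
    ext s
    simp only [NeedsAtMost, Set.mem_iInter, Set.mem_union, Set.mem_compl_iff, Set.mem_ofPred_eq]
    exact forall_congr' fun j => by tauto
  rw [this]
  exact MeasurableSet.iInter fun j =>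
    (measurableSet_lt measurable_const (P.measurable_blockLength τ)).compl.union
      ((P.measurableSet_forced_apply none j).compl.union
        (P.measurableSet_lt_extRateLength τ k j))

lemma measurableSet_isRenewal (m : ℕ) : MeasurableSet {s | P.IsRenewal τ m s} := by
  induction m with
  | zero => simp [IsRenewal]
  | succ m ih =>
    exact (P.measurableSet_needsAtMost τ m).inter (ih.preimage (P.measurable_dropBlock τ))

lemma measurable_totalLength (m : ℕ) : Measurable (P.totalLength τ m) := by
  induction m with
  | zero => exact measurable_const
  | succ m ih => exact (P.measurable_blockLength τ).add (ih.comp (P.measurable_dropBlock τ))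

/-! ### The strong Markov property at the blocks -/

/-- Membership in `E` is decided by the first block. -/
def DependsOnBlock (E : Set (ℕ → ℝ)) : Prop :=
  ∀ s s' : ℕ → ℝ, 1 ≤ P.blockLength τ s → (∀ i < P.blockLength τ s, s i = s' i) → s ∈ E → s' ∈ E

lemma dependsOnBlock_univ : P.DependsOnBlock τ Set.univ := fun _ _ _ _ _ => trivial

lemma dependsOnBlock_blockLength (B : Set ℕ) :
    P.DependsOnBlock τ (P.blockLength τ ⁻¹' B) := fun s s' h1 h hs => by
  rw [Set.mem_preimage, blockLength_congr h1 fun i hi => by rw [h i hi]]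
  exact hs

lemma dependsOnBlock_needsAtMost (k : ℕ) : P.DependsOnBlock τ {s | P.NeedsAtMost τ k s} := by
  intro s s' h1 h hs j hj
  have hB := isBlock_blockLength h1
  rw [blockLength_congr h1 fun i hi => by rw [h i hi]] at hj
  rw [← h j hj]
  refine or_iff_not_imp_left.2 fun hf => ?_
  have hj' : j + 1 < P.blockLength τ s := by
    rcases Nat.lt_or_ge (j + 1) (P.blockLength τ s) with h2 | h2
    · exact h2
    · have : j = P.blockLength τ s - 1 := by omega
      exact absurd (this ▸ hB.2.1) hf
  rw [backContext_eq (hB.2.2 (j + 1) hj') fun i hi => by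
    rw [shift_apply, shift_apply, h _ (by omega)]]
  exact (hs j hj).resolve_left hf

variable {P τ}

lemma ae_one_le_blockLength (hB : ∀ᵐ s ∂driveLaw, P.HasBlocks τ s) :
    ∀ᵐ s ∂driveLaw, 1 ≤ P.blockLength τ s := by
  filter_upwards [hB] with s hs using hs.isBlock.1

/-- The driving sequence before the first block is independent of this block, and it has the law
of the whole sequence. -/
lemma driveLaw_inter_preimage_dropBlock (hB : ∀ᵐ s ∂driveLaw, P.HasBlocks τ s)
    {E C : Set (ℕ → ℝ)} (hE : MeasurableSet E) (hEb : P.DependsOnBlock τ E)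
    (hC : MeasurableSet C) :
    driveLaw (E ∩ P.dropBlock τ ⁻¹' C) = driveLaw E * driveLaw C := by
  have hm := P.measurable_blockLength τ
  rw [measure_eq_tsum_fiber driveLaw hm (E ∩ P.dropBlock τ ⁻¹' C),
    measure_eq_tsum_fiber driveLaw hm E, ← ENNReal.tsum_mul_right]
  congr 1; ext n
  rcases Nat.eq_zero_or_pos n with rfl | hn
  · have h0 : driveLaw (P.blockLength τ ⁻¹' {0}) = 0 := by
      refine measure_mono_null (fun s hs => ?_) (ae_one_le_blockLength hB)
      have : P.blockLength τ s = 0 := hs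
      simp [this]
    rw [measure_mono_null Set.inter_subset_right h0, measure_mono_null Set.inter_subset_right h0,
      zero_mul]
  · have hset : E ∩ P.dropBlock τ ⁻¹' C ∩ P.blockLength τ ⁻¹' {n} =
        (E ∩ P.blockLength τ ⁻¹' {n}) ∩ shift n ⁻¹' C := by
      ext s
      simp only [Set.mem_inter_iff, Set.mem_preimage, Set.mem_singleton_iff, dropBlock]
      constructor
      · rintro ⟨⟨h1, h2⟩, rfl⟩; exact ⟨⟨h1, rfl⟩, h2⟩
      · rintro ⟨⟨h1, rfl⟩, h2⟩; exact ⟨⟨h1, h2⟩, rfl⟩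
    rw [hset, driveLaw_inter_preimage_shift (hE.inter (hm (measurableSet_singleton n))) _ hC]
    rintro s s' h ⟨hs, hsn⟩
    have hsn : P.blockLength τ s = n := hsn
    refine ⟨hEb s s' (by omega) (by rwa [hsn]) hs, ?_⟩
    exact P.dependsOnBlock_blockLength τ {n} s s' (by omega) (by rwa [hsn]) hsn

lemma driveLaw_preimage_dropBlock (hB : ∀ᵐ s ∂driveLaw, P.HasBlocks τ s)
    {C : Set (ℕ → ℝ)} (hC : MeasurableSet C) :
    driveLaw (P.dropBlock τ ⁻¹' C) = driveLaw C := by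
  have := driveLaw_inter_preimage_dropBlock hB MeasurableSet.univ (P.dependsOnBlock_univ τ) hC
  rwa [Set.univ_inter, measure_univ, one_mul] at this

lemma map_dropBlock (hB : ∀ᵐ s ∂driveLaw, P.HasBlocks τ s) :
    driveLaw.map (P.dropBlock τ) = driveLaw := by
  ext C hC
  rw [Measure.map_apply (P.measurable_dropBlock τ) hC, driveLaw_preimage_dropBlock hB hC]

lemma indepFun_blockLength_dropBlock (hB : ∀ᵐ s ∂driveLaw, P.HasBlocks τ s) :
    IndepFun (P.blockLength τ) (P.dropBlock τ) driveLaw := by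
  rw [indepFun_iff_measure_inter_preimage_eq_mul]
  intro B C hBm hC
  rw [driveLaw_inter_preimage_dropBlock hB (P.measurable_blockLength τ hBm)
    (P.dependsOnBlock_blockLength τ B) hC, driveLaw_preimage_dropBlock hB hC]

end PastKernel

/-! ### Renewal sequences -/

section RenewalSequences

variable {u r : ℕ → ℝ}

lemma mul_sum_le_one_of_renewal (hu : ∀ m, 0 ≤ u m) (hr : Antitone r)
    (h : ∀ M, ∑ m ∈ Finset.range (M + 1), u m * r (M - m) = 1) (M : ℕ) :
    r M * ∑ m ∈ Finset.range (M + 1), u m ≤ 1 := by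
  rw [← h M, Finset.mul_sum]
  refine Finset.sum_le_sum fun m _ => ?_
  rw [mul_comm]
  exact mul_le_mul_of_nonneg_left (hr (Nat.sub_le M m)) (hu m)

/-- A recurrent renewal sequence: if `∑ u = ∞`, then there is almost surely a renewal. -/
lemma tendsto_zero_of_renewal (hu : ∀ m, 0 ≤ u m) (hr0 : ∀ m, 0 ≤ r m) (hr : Antitone r)
    (h : ∀ M, ∑ m ∈ Finset.range (M + 1), u m * r (M - m) = 1) (hns : ¬ Summable u) :
    Tendsto r atTop (𝓝 0) := by
  have hT : Tendsto (fun M => ∑ m ∈ Finset.range (M + 1), u m) atTop atTop :=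
    (tendsto_add_atTop_iff_nat 1).2 ((not_summable_iff_tendsto_nat_atTop_of_nonneg hu).1 hns)
  refine squeeze_zero' (Eventually.of_forall hr0) ?_ hT.inv_tendsto_atTop
  filter_upwards [hT.eventually_gt_atTop 0] with M hM
  rw [Pi.inv_apply, ← one_div, le_div_iff₀ hM]
  exact mul_sum_le_one_of_renewal hu hr h M

/-- A positive recurrent renewal sequence: if `u` is bounded below, then the first renewal time has
finite mean. -/
lemma summable_of_renewal {c : ℝ} (hc : 0 < c) (hu : ∀ m, c ≤ u m) (hr0 : ∀ m, 0 ≤ r m)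
    (h : ∀ M, ∑ m ∈ Finset.range (M + 1), u m * r (M - m) = 1) : Summable r := by
  refine summable_of_sum_range_le (c := 1 / c) hr0 fun n => ?_
  have h1 : ∑ j ∈ Finset.range n, r j ≤ ∑ m ∈ Finset.range (n + 1), r (n - m) := by
    refine (Finset.sum_le_sum_of_subset_of_nonneg (Finset.range_subset_range.2 n.le_succ)
      fun j _ _ => hr0 j).trans_eq ?_
    rw [← Finset.sum_range_reflect r (n + 1)]
    simp
  rw [le_div_iff₀ hc, ← h n]
  refine (mul_le_mul_of_nonneg_right h1 hc.le).trans ?_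
  rw [Finset.sum_mul]
  refine Finset.sum_le_sum fun m _ => ?_
  rw [mul_comm]
  exact mul_le_mul_of_nonneg_right (hu m) (hr0 _)

/-- The sequence `r` satisfies the renewal equation with the defective distribution
`u m - u (m + 1)`. -/
lemma renewal_succ (hu0 : u 0 = 1)
    (h : ∀ M, ∑ m ∈ Finset.range (M + 1), u m * r (M - m) = 1) (M : ℕ) :
    r (M + 1) = ∑ m ∈ Finset.range (M + 1), (u m - u (m + 1)) * r (M - m) := by
  have h1 := h (M + 1)
  rw [Finset.sum_range_succ', hu0] at h1
  simp only [Nat.add_sub_add_right, Nat.sub_zero, one_mul] at h1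
  simp only [sub_mul, Finset.sum_sub_distrib, h M]
  linarith

/-- If `u` is bounded below and its increments decay exponentially fast, then the first renewal time
has exponential tail: the defective distribution `u m - u (m + 1)` keeps a mass at most one
when it is multiplied by `θ ^ (m + 1)` for some `θ > 1`. -/
lemma exists_geometric_of_renewal {c C ρ : ℝ} (hc : 0 < c) (hu0 : u 0 = 1) (hu : ∀ m, c ≤ u m)
    (hanti : Antitone u) (hr0 : r 0 = 1)
    (h : ∀ M, ∑ m ∈ Finset.range (M + 1), u m * r (M - m) = 1)
    (hC : 0 < C) (hρ0 : 0 < ρ) (hρ1 : ρ < 1) (hw : ∀ m, u m - u (m + 1) ≤ C * ρ ^ m) :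
    ∃ θ : ℝ, 1 < θ ∧ ∀ M, r M ≤ θ⁻¹ ^ M := by
  have hw0 : ∀ m, 0 ≤ u m - u (m + 1) := fun m => sub_nonneg.2 (hanti m.le_succ)
  have hsumw : ∀ K, ∑ m ∈ Finset.range K, (u m - u (m + 1)) ≤ 1 - c := fun K => by
    rw [Finset.sum_range_sub', hu0]; linarith [hu K]
  set θ₀ : ℝ := 2 / (1 + ρ) with hθ₀
  have hθ₀1 : 1 < θ₀ := by rw [hθ₀, lt_div_iff₀ (by linarith)]; linarith
  have hρθ : ρ * θ₀ < 1 := by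
    rw [hθ₀, mul_div_assoc', div_lt_one (by linarith)]; linarith
  have hρθ0 : 0 ≤ ρ * θ₀ := by positivity
  set S : ℝ := C * θ₀ * (1 - ρ * θ₀)⁻¹ with hS
  have hS0 : 0 < S := by
    have : 0 < 1 - ρ * θ₀ := by linarith
    positivity
  have hsumS : ∀ K, ∑ m ∈ Finset.range K, (u m - u (m + 1)) * θ₀ ^ (m + 1) ≤ S := fun K => by
    have h1 : ∀ m ∈ Finset.range K, (u m - u (m + 1)) * θ₀ ^ (m + 1) ≤
        C * θ₀ * (ρ * θ₀) ^ m := fun m _ => by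
      calc (u m - u (m + 1)) * θ₀ ^ (m + 1) ≤ C * ρ ^ m * θ₀ ^ (m + 1) := by
            gcongr; exact hw m
        _ = _ := by rw [mul_pow]; ring
    refine (Finset.sum_le_sum h1).trans ?_
    rw [← Finset.mul_sum]
    refine mul_le_mul_of_nonneg_left ?_ (by positivity)
    rw [← tsum_geometric_of_lt_one hρθ0 hρθ]
    exact (summable_geometric_of_lt_one hρθ0 hρθ).sum_le_tsum _ fun _ _ => by positivity
  set t : ℝ := min 1 (c / S) with ht
  have ht0 : 0 < t := lt_min one_pos (by positivity)
  have ht1 : t ≤ 1 := min_le_left _ _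
  have htS : t * S ≤ c := by
    calc t * S ≤ c / S * S := by gcongr; exact min_le_right _ _
      _ = c := by field_simp
  have hc1 : c ≤ 1 := (hu 0).trans_eq hu0
  set θ : ℝ := θ₀ ^ t with hθ
  have hθ1 : 1 < θ := Real.one_lt_rpow hθ₀1 ht0
  have hθ0 : 0 < θ := by linarith
  -- By convexity, `θ ^ n ≤ (1 - t) + t θ₀ ^ n`.
  have hconv : ∀ n : ℕ, θ ^ n ≤ (1 - t) + t * θ₀ ^ n := fun n => by
    have h1 := Real.geom_mean_le_arith_mean2_weighted (w₁ := 1 - t) (w₂ := t) (p₁ := 1)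
      (p₂ := θ₀ ^ n) (by linarith) ht0.le zero_le_one (by positivity) (by ring)
    rw [Real.one_rpow, one_mul, mul_one] at h1
    refine le_trans (le_of_eq ?_) h1
    rw [hθ, ← Real.rpow_natCast (θ₀ ^ t), ← Real.rpow_natCast θ₀, ← Real.rpow_mul (by linarith),
      ← Real.rpow_mul (by linarith), mul_comm]
  have hsumθ : ∀ K, ∑ m ∈ Finset.range K, (u m - u (m + 1)) * θ ^ (m + 1) ≤ 1 := fun K => by
    calc ∑ m ∈ Finset.range K, (u m - u (m + 1)) * θ ^ (m + 1)
        ≤ ∑ m ∈ Finset.range K, (u m - u (m + 1)) * ((1 - t) + t * θ₀ ^ (m + 1)) :=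
          Finset.sum_le_sum fun m _ => mul_le_mul_of_nonneg_left (hconv _) (hw0 m)
      _ = (1 - t) * ∑ m ∈ Finset.range K, (u m - u (m + 1)) +
          t * ∑ m ∈ Finset.range K, (u m - u (m + 1)) * θ₀ ^ (m + 1) := by
          rw [Finset.mul_sum, Finset.mul_sum, ← Finset.sum_add_distrib]
          exact Finset.sum_congr rfl fun m _ => by ring
      _ ≤ (1 - t) * (1 - c) + t * S := by
          exact add_le_add (mul_le_mul_of_nonneg_left (hsumw K) (by linarith))
            (mul_le_mul_of_nonneg_left (hsumS K) ht0.le)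
      _ ≤ 1 := by linarith [mul_nonneg ht0.le (sub_nonneg.2 hc1), mul_comm t c]
  refine ⟨θ, hθ1, fun M => ?_⟩
  induction M using Nat.strong_induction_on with
  | _ M ih =>
    cases M with
    | zero => simp [hr0]
    | succ M =>
      rw [renewal_succ hu0 h M]
      calc ∑ m ∈ Finset.range (M + 1), (u m - u (m + 1)) * r (M - m)
          ≤ ∑ m ∈ Finset.range (M + 1), (u m - u (m + 1)) * θ ^ (m + 1) * θ⁻¹ ^ (M + 1) := by
            refine Finset.sum_le_sum fun m hm => ?_
            have hm' : m ≤ M := Nat.lt_succ_iff.1 (Finset.mem_range.1 hm)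
            rw [mul_assoc]
            refine mul_le_mul_of_nonneg_left ((ih (M - m) (by omega)).trans_eq ?_) (hw0 m)
            rw [show M + 1 = (M - m) + (m + 1) by omega, pow_add _ (M - m), mul_left_comm,
              ← mul_pow, mul_inv_cancel₀ hθ0.ne', one_pow, mul_one]
        _ = (∑ m ∈ Finset.range (M + 1), (u m - u (m + 1)) * θ ^ (m + 1)) * θ⁻¹ ^ (M + 1) := by
            rw [Finset.sum_mul]
        _ ≤ 1 * θ⁻¹ ^ (M + 1) := by
            gcongr; exact hsumθ _
        _ = _ := one_mul _

/-- A product of positive factors at least `δ` whose defects are summable is bounded below. -/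
lemma exists_le_prod_of_summable {p : ℕ → ℝ} {δ : ℝ} (hδ : 0 < δ) (hp : ∀ j, δ ≤ p j)
    (hp1 : ∀ j, p j ≤ 1) (hs : Summable fun j => 1 - p j) :
    ∃ c > 0, ∀ m, c ≤ ∏ j ∈ Finset.range m, p j := by
  have hδ1 : δ ≤ 1 := (hp 0).trans (hp1 0)
  obtain ⟨N, hN⟩ : ∃ N, ∑' j, (1 - p (j + N)) < 1 / 2 :=
    ((tendsto_sum_nat_add fun j => 1 - p j).eventually (gt_mem_nhds one_half_pos)).exists
  have hs' : Summable fun j => 1 - p (j + N) := (summable_nat_add_iff N).2 hs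
  have htail : ∀ m, 1 / 2 ≤ ∏ j ∈ Finset.range m, p (j + N) := fun m => by
    have h1 : 1 - ∑ j ∈ Finset.range m, (1 - p (j + N)) ≤ ∏ j ∈ Finset.range m, p (j + N) := by
      induction m with
      | zero => simp
      | succ m ih =>
        rw [Finset.sum_range_succ, Finset.prod_range_succ]
        have h2 : ∏ j ∈ Finset.range m, p (j + N) ≤ 1 :=
          Finset.prod_le_one (fun j _ => hδ.le.trans (hp _)) fun j _ => hp1 _
        nlinarith [hp1 (m + N)]
    have h2 := hs'.sum_le_tsum (Finset.range m) fun j _ => sub_nonneg.2 (hp1 (j + N))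
    linarith
  have hpos : ∀ m, 0 ≤ ∏ j ∈ Finset.range m, p j := fun m =>
    Finset.prod_nonneg fun j _ => hδ.le.trans (hp j)
  refine ⟨δ ^ N * (1 / 2), by positivity, fun m => ?_⟩
  have hanti : ∏ j ∈ Finset.range (N + m), p j ≤ ∏ j ∈ Finset.range m, p j := by
    rw [add_comm, Finset.prod_range_add]
    exact mul_le_of_le_one_right (hpos m)
      (Finset.prod_le_one (fun j _ => hδ.le.trans (hp _)) fun j _ => hp1 _)
  refine le_trans ?_ hanti
  rw [Finset.prod_range_add]
  have h1 : δ ^ N ≤ ∏ j ∈ Finset.range N, p j := by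
    calc δ ^ N = ∏ j ∈ Finset.range N, δ := by simp
      _ ≤ _ := Finset.prod_le_prod (fun _ _ => hδ.le) fun j _ => hp j
  refine mul_le_mul h1 ?_ (by norm_num) (hpos N)
  simpa [add_comm] using htail m

end RenewalSequences

namespace PastKernel

variable {A : Type*} [Encodable A] [Nonempty A] (P : PastKernel A) (τ : ContextTree A)

/-! ### The renewal process of the blocks -/

/-- None of the times `1, …, M` is a renewal. -/
def NoRenewal (M : ℕ) (s : ℕ → ℝ) : Prop := ∀ m, 1 ≤ m → m ≤ M → ¬ P.IsRenewal τ m s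

/-- The probability that no symbol of the first block needs more than `k` contexts beyond the most
recent one. -/
noncomputable def needProb (k : ℕ) : ℝ := driveLaw.real {s | P.NeedsAtMost τ k s}

/-- The probability that `m` is a renewal. -/
noncomputable def renewalProb (m : ℕ) : ℝ := driveLaw.real {s | P.IsRenewal τ m s}

/-- The probability that none of the times `1, …, M` is a renewal. -/
noncomputable def noRenewalProb (M : ℕ) : ℝ := driveLaw.real {s | P.NoRenewal τ M s}

lemma measurableSet_noRenewal (M : ℕ) : MeasurableSet {s | P.NoRenewal τ M s} := by
  have : {s | P.NoRenewal τ M s} = ⋂ m ∈ Set.Icc 1 M, {s | P.IsRenewal τ m s}ᶜ := by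
    ext s; simp [NoRenewal]
  rw [this]
  exact MeasurableSet.biInter (Set.to_countable _) fun m _ => (P.measurableSet_isRenewal τ m).compl

variable {P τ}

lemma NeedsAtMost.mono {j k : ℕ} (hjk : j ≤ k) {s : ℕ → ℝ} (h : P.NeedsAtMost τ j s) :
    P.NeedsAtMost τ k s := fun i hi =>
  (h i hi).imp_right fun h => h.trans_le (P.extRateLength_mono τ _ hjk)

lemma NoRenewal.mono {j k : ℕ} (hjk : j ≤ k) {s : ℕ → ℝ} (h : P.NoRenewal τ k s) :
    P.NoRenewal τ j s := fun m h1 h2 => h m h1 (h2.trans hjk)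

/-- After a renewal, the renewals are those of the remaining sequence. -/
lemma IsRenewal.add_iff {m j : ℕ} {s : ℕ → ℝ} (h : P.IsRenewal τ m s) :
    P.IsRenewal τ (m + j) s ↔ P.IsRenewal τ j ((P.dropBlock τ)^[m] s) := by
  induction m generalizing s with
  | zero => simp
  | succ m ih =>
    rw [Function.iterate_succ_apply, ← ih h.2, show m + 1 + j = (m + j) + 1 by omega]
    exact ⟨fun h' => h'.2, fun h' => ⟨h.1.mono (by omega), h'⟩⟩

lemma totalLength_mono (s : ℕ → ℝ) : Monotone fun m => P.totalLength τ m s := by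
  refine monotone_nat_of_le_succ fun m => ?_
  induction m generalizing s with
  | zero => exact Nat.zero_le _
  | succ m ih => exact Nat.add_le_add_left (ih _) _

lemma totalLength_eq_sum (m : ℕ) (s : ℕ → ℝ) :
    P.totalLength τ m s = ∑ n ∈ Finset.range m, P.blockLength τ ((P.dropBlock τ)^[n] s) := by
  induction m generalizing s with
  | zero => rfl
  | succ m ih => rw [totalLength, ih, Finset.sum_range_succ']; simp [add_comm]

variable (hB : ∀ᵐ s ∂driveLaw, P.HasBlocks τ s)

lemma measurable_iterate_dropBlock (m : ℕ) : Measurable (P.dropBlock τ)^[m] :=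
  (P.measurable_dropBlock τ).iterate m

include hB

lemma map_iterate_dropBlock (m : ℕ) : driveLaw.map (P.dropBlock τ)^[m] = driveLaw := by
  induction m with
  | zero => simp
  | succ m ih =>
    rw [Function.iterate_succ,
      ← Measure.map_map (measurable_iterate_dropBlock m) (P.measurable_dropBlock τ),
      map_dropBlock hB, ih]

lemma isRenewal_inter (m : ℕ) {C : Set (ℕ → ℝ)} (hC : MeasurableSet C) :
    driveLaw.real ({s | P.IsRenewal τ m s} ∩ (P.dropBlock τ)^[m] ⁻¹' C) =
      P.renewalProb τ m * driveLaw.real C := by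
  simp only [renewalProb, Measure.real, ← ENNReal.toReal_mul]
  congr 1
  induction m with
  | zero => simp [IsRenewal]
  | succ m ih =>
    have h1 := driveLaw_inter_preimage_dropBlock hB (P.measurableSet_needsAtMost τ m)
      (P.dependsOnBlock_needsAtMost τ m)
      ((P.measurableSet_isRenewal τ m).inter
        (hC.preimage (measurable_iterate_dropBlock (P := P) (τ := τ) m)))
    have h2 := driveLaw_inter_preimage_dropBlock hB (P.measurableSet_needsAtMost τ m)
      (P.dependsOnBlock_needsAtMost τ m) (P.measurableSet_isRenewal τ m)
    rw [ih, ← mul_assoc, ← h2] at h1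
    rw [show {s | P.IsRenewal τ (m + 1) s} =
      {s | P.NeedsAtMost τ m s} ∩ P.dropBlock τ ⁻¹' {s | P.IsRenewal τ m s} from rfl, ← h1,
      Set.preimage_inter, ← Set.preimage_comp, ← Function.iterate_succ, Set.inter_assoc]

omit hB in
lemma renewalProb_zero : P.renewalProb τ 0 = 1 := by simp [renewalProb, IsRenewal]

lemma renewalProb_succ (m : ℕ) :
    P.renewalProb τ (m + 1) = P.needProb τ m * P.renewalProb τ m := by
  simp only [renewalProb, needProb, Measure.real, ← ENNReal.toReal_mul]
  congr 1
  exact driveLaw_inter_preimage_dropBlock hB (P.measurableSet_needsAtMost τ m)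
      (P.dependsOnBlock_needsAtMost τ m) (P.measurableSet_isRenewal τ m)

lemma renewalProb_eq_prod (m : ℕ) :
    P.renewalProb τ m = ∏ j ∈ Finset.range m, P.needProb τ j := by
  induction m with
  | zero => simp [renewalProb_zero]
  | succ m ih => rw [renewalProb_succ hB, ih, Finset.prod_range_succ, mul_comm]

/-- Decomposition according to the last renewal in `{0, …, M}`. -/
lemma sum_renewalProb_mul (M : ℕ) {C : Set (ℕ → ℝ)} (hC : MeasurableSet C) :
    ∑ m ∈ Finset.range (M + 1), P.renewalProb τ m *
        driveLaw.real ({s | P.NoRenewal τ (M - m) s} ∩ (P.dropBlock τ)^[M - m] ⁻¹' C) =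
      driveLaw.real C := by
  have hmeas : ∀ n, MeasurableSet ({s | P.NoRenewal τ n s} ∩ (P.dropBlock τ)^[n] ⁻¹' C) :=
    fun n => (P.measurableSet_noRenewal τ n).inter (hC.preimage (measurable_iterate_dropBlock n))
  set E : ℕ → Set (ℕ → ℝ) := fun m => {s | P.IsRenewal τ m s} ∩ (P.dropBlock τ)^[m] ⁻¹'
    ({s | P.NoRenewal τ (M - m) s} ∩ (P.dropBlock τ)^[M - m] ⁻¹' C) with hE
  have hdisj : ∀ i j s, i < j → j ≤ M → s ∈ E i → s ∈ E j → False := by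
    rintro i j s hij hj ⟨hi1, hi2, -⟩ ⟨hj1, -⟩
    obtain ⟨d, rfl⟩ := Nat.exists_eq_add_of_lt hij
    have hi1 : P.IsRenewal τ i s := hi1
    exact hi2 (d + 1) (by omega) (by omega) (hi1.add_iff.1 hj1)
  have hunion : ⋃ m ∈ Finset.range (M + 1), E m = (P.dropBlock τ)^[M] ⁻¹' C := by
    classical
    ext s
    simp only [Set.mem_iUnion, Finset.mem_range, exists_prop]
    have hit : ∀ m ≤ M, (P.dropBlock τ)^[M - m] ((P.dropBlock τ)^[m] s) = (P.dropBlock τ)^[M] s :=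
      fun m hm => by rw [← Function.iterate_add_apply, Nat.sub_add_cancel hm]
    constructor
    · rintro ⟨m, hm, -, -, h⟩
      simp only [Set.mem_preimage] at h ⊢
      rwa [hit m (by omega)] at h
    · intro hs
      set m := Nat.findGreatest (fun m => P.IsRenewal τ m s) M with hm
      have hmM : m ≤ M := Nat.findGreatest_le M
      have hm1 : P.IsRenewal τ m s :=
        Nat.findGreatest_spec (P := fun m => P.IsRenewal τ m s) M.zero_le trivial
      refine ⟨m, by omega, hm1, fun j hj1 hj2 hj => ?_, ?_⟩
      · have := Nat.le_findGreatest (P := fun m => P.IsRenewal τ m s) (n := M) (m := m + j)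
          (by omega) (hm1.add_iff.2 hj)
        omega
      · simp only [Set.mem_preimage]
        rwa [hit m hmM]
  have hCM : driveLaw.real C = driveLaw.real ((P.dropBlock τ)^[M] ⁻¹' C) := by
    rw [Measure.real, Measure.real, ← Measure.map_apply (measurable_iterate_dropBlock M) hC,
      map_iterate_dropBlock hB]
  rw [hCM, ← hunion, measureReal_biUnion_finset]
  · exact Finset.sum_congr rfl fun m _ => (isRenewal_inter hB m (hmeas (M - m))).symm
  · intro i hi j hj hij
    have hi' : i ≤ M := by simpa [Nat.lt_succ_iff] using hi
    have hj' : j ≤ M := by simpa [Nat.lt_succ_iff] using hj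
    refine Set.disjoint_left.2 fun s hsi hsj => ?_
    rcases lt_or_gt_of_ne hij with h | h
    · exact hdisj i j s h hj' hsi hsj
    · exact hdisj j i s h hi' hsj hsi
  · exact fun m _ => (P.measurableSet_isRenewal τ m).inter
      ((hmeas (M - m)).preimage (measurable_iterate_dropBlock m))

lemma sum_renewalProb_mul_noRenewalProb (M : ℕ) :
    ∑ m ∈ Finset.range (M + 1), P.renewalProb τ m * P.noRenewalProb τ (M - m) = 1 := by
  have := sum_renewalProb_mul hB M MeasurableSet.univ
  simpa [noRenewalProb] using this

/-- The absence of renewals up to `n` is independent of the sequence before the `n`-th block. -/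
lemma noRenewal_inter (n : ℕ) {C : Set (ℕ → ℝ)} (hC : MeasurableSet C) :
    driveLaw.real ({s | P.NoRenewal τ n s} ∩ (P.dropBlock τ)^[n] ⁻¹' C) =
      P.noRenewalProb τ n * driveLaw.real C := by
  induction n using Nat.strong_induction_on with
  | _ n ih =>
    have h1 := sum_renewalProb_mul hB n hC
    have h2 := congrArg (· * driveLaw.real C) (sum_renewalProb_mul_noRenewalProb hB n)
    simp only [one_mul] at h2
    rw [Finset.sum_mul, Finset.sum_range_succ'] at h2
    rw [Finset.sum_range_succ'] at h1
    simp only [renewalProb_zero, one_mul, Nat.sub_zero] at h1 h2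
    have h3 : ∀ m ∈ Finset.range n, P.renewalProb τ (m + 1) *
        driveLaw.real ({s | P.NoRenewal τ (n - (m + 1)) s} ∩
          (P.dropBlock τ)^[n - (m + 1)] ⁻¹' C) =
        P.renewalProb τ (m + 1) * P.noRenewalProb τ (n - (m + 1)) * driveLaw.real C := by
      intro m hm
      have := Finset.mem_range.1 hm
      rw [ih _ (by omega), mul_assoc]
    rw [Finset.sum_congr rfl h3] at h1
    linarith

omit hB in
lemma noRenewalProb_zero : P.noRenewalProb τ 0 = 1 := by
  have : {s | P.NoRenewal τ 0 s} = Set.univ := by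
    ext s; simp only [NoRenewal, Set.mem_ofPred_eq, Set.mem_univ, iff_true]; intro m h1 h2; omega
  simp [noRenewalProb, this]

omit hB in
lemma noRenewalProb_antitone : Antitone (P.noRenewalProb τ) := fun _ _ hij =>
  measureReal_mono fun _ hs => NoRenewal.mono hij hs

omit hB in
lemma needProb_le_one (k : ℕ) : P.needProb τ k ≤ 1 := measureReal_le_one

omit hB in
lemma needProb_mono : Monotone (P.needProb τ) := fun _ _ hij =>
  measureReal_mono fun _ hs => NeedsAtMost.mono hij hs

lemma renewalProb_antitone : Antitone (P.renewalProb τ) :=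
  antitone_nat_of_succ_le fun m => by
    rw [renewalProb_succ hB]
    exact mul_le_of_le_one_left measureReal_nonneg (needProb_le_one m)

/-! ### Tails of the lengths of the blocks -/

/-- The `n`-th term of Wald's identity for the total length of the blocks up to the first
renewal. -/
lemma lintegral_noRenewal_blockLength (n : ℕ) :
    ∫⁻ s in {s | P.NoRenewal τ n s}, (P.blockLength τ ((P.dropBlock τ)^[n] s) : ENNReal)
        ∂driveLaw =
      ENNReal.ofReal (P.noRenewalProb τ n) * ∫⁻ s, (P.blockLength τ s : ENNReal) ∂driveLaw := by
  have hmap : (driveLaw.restrict {s | P.NoRenewal τ n s}).map (P.dropBlock τ)^[n] =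
      ENNReal.ofReal (P.noRenewalProb τ n) • driveLaw := by
    ext C hC
    rw [Measure.map_apply (measurable_iterate_dropBlock n) hC,
      Measure.restrict_apply (hC.preimage (measurable_iterate_dropBlock n)), Set.inter_comm,
      Measure.smul_apply, smul_eq_mul, ← ofReal_measureReal, noRenewal_inter hB n hC,
      noRenewalProb, ENNReal.ofReal_mul measureReal_nonneg, ofReal_measureReal (s := C)]
  have hf : Measurable fun s => (P.blockLength τ s : ENNReal) :=
    (measurable_of_countable (fun n : ℕ => (n : ENNReal))).comp (P.measurable_blockLength τ)
  rw [← lintegral_map hf (measurable_iterate_dropBlock n), hmap, lintegral_smul_measure,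
    smul_eq_mul]

lemma lintegral_pow_totalLength (a : ENNReal) (m : ℕ) :
    ∫⁻ s, a ^ P.totalLength τ m s ∂driveLaw = (∫⁻ s, a ^ P.blockLength τ s ∂driveLaw) ^ m := by
  have hpow : Measurable fun n : ℕ => a ^ n := measurable_of_countable _
  induction m with
  | zero => simp [totalLength]
  | succ m ih =>
    have h1 := lintegral_mul_eq_lintegral_mul_lintegral_of_indepFun
      (hpow.comp (P.measurable_blockLength τ))
      ((hpow.comp (P.measurable_totalLength τ m)).comp (P.measurable_dropBlock τ))
      ((indepFun_blockLength_dropBlock hB).comp hpow (hpow.comp (P.measurable_totalLength τ m)))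
    have h2 : ∫⁻ s, a ^ P.totalLength τ m (P.dropBlock τ s) ∂driveLaw =
        ∫⁻ s, a ^ P.totalLength τ m s ∂driveLaw := by
      conv_rhs => rw [← map_dropBlock hB]
      exact (lintegral_map (hpow.comp (P.measurable_totalLength τ m))
        (P.measurable_dropBlock τ)).symm
    have h0 : ∀ s, a ^ P.totalLength τ (m + 1) s =
        a ^ P.blockLength τ s * a ^ P.totalLength τ m (P.dropBlock τ s) := fun s => by
      rw [totalLength, pow_add]
    simp only [h0]
    have h3 := _root_.pow_succ' (∫⁻ s, a ^ P.blockLength τ s ∂driveLaw) m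
    rw [← ih, ← h2] at h3
    exact h1.trans h3.symm

end PastKernel

namespace PastKernel

variable {A : Type*} [Encodable A] [Nonempty A] {P : PastKernel A} {τ : ContextTree A}

/-! ### Good coalescence times and blocks -/

lemma nil_mem_of_backContext_le {s : ℕ → ℝ} (h : P.backContext τ s ≤ 0) :
    PastString.fin [] ∈ τ.contexts := by
  set x : Stream' A := Stream'.const (Classical.arbitrary A)
  have hl : (τ.context x).length ≤ P.backContext τ s :=
    length_context_le (D := 0) (by simpa using h) fun i hi => by omega
  have hm := τ.context_mem x
  cases hc : τ.context x with
  | inf t => simp [hc, PastString.length] at hl; simp [hl] at h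
  | fin l =>
    rw [hc] at hl hm
    have : l = [] := by simpa [PastString.length] using hl.trans h
    rwa [this] at hm

/-- The empty string is a context only of the trivial tree, for which extended local continuity
means that all symbols are forced. -/
lemma alphaTotal_eq_one_of_nil_mem (hP : P.IsExtLC τ) (h : PastString.fin [] ∈ τ.contexts) :
    P.alphaTotal = 1 := by
  have hctx : ∀ x, τ.context x = PastString.fin [] := fun x =>
    τ.context_eq h (PastString.fin_isSuffix_inf.2 rfl)
  have hstr : ∀ k x, τ.contextString k x = PastString.fin [] := by
    intro k
    induction k with
    | zero => exact hctx
    | succ k ih => intro x; rw [ContextTree.contextString, hctx, ih]; rfl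
  set x : Stream' A := Stream'.const (Classical.arbitrary A)
  refine le_antisymm P.alphaTotal_le_one (le_of_tendsto (hP [] h) (Eventually.of_forall fun k => ?_))
  have := P.extRate_le τ k x
  simp only [hctx, levelWeight, hstr] at this
  exact this

lemma forced_ne_none_of_alphaTotal (h : P.alphaTotal = 1) {t : ℝ} (ht : t ∈ Set.Ico (0 : ℝ) 1) :
    P.forced t ≠ none := by
  rwa [forced_ne_none_iff, h]

lemma isBlock_of_isGoodTime (hP : P.IsExtLC τ) {u : ℤ → ℝ} (hu : ∀ i, u i ∈ Set.Ico (0 : ℝ) 1)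
    {i : ℤ} (hg : P.IsGoodTime τ u 0 i) (hw : P.ContextsInWindow τ u 0 i) :
    P.IsBlock τ (backward u 0) (i.natAbs + 1) := by
  have hi := hg.1
  refine ⟨by omega, ?_, fun j hj => ?_⟩
  · have hend : backward u 0 (i.natAbs + 1 - 1) = u i := by
      simp only [backward]; congr 1; omega
    rw [hend]
    rcases hg.2 i le_rfl hi with h | h
    · exact Option.isSome_iff_ne_none.1 h
    · rw [maxContextLength_eq, sub_self] at h
      exact forced_ne_none_of_alphaTotal
        (alphaTotal_eq_one_of_nil_mem hP (nil_mem_of_backContext_le (by simpa using h))) (hu i)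
  · have := hw (0 - j) (by omega) (by omega)
    rw [maxContextLength_eq] at this
    rw [shift_backward]
    refine this.trans_eq ?_
    congr 1
    omega

end PastKernel

/-- Each of the driving variables lies in `[0, 1)` almost surely. -/
lemma ae_mem_Ico {Ω : Type*} [MeasurableSpace Ω] {μ : Measure Ω} {U : ℤ → Ω → ℝ}
    (hU : IsIIDUniform μ U) : ∀ᵐ ω ∂μ, ∀ i, U i ω ∈ Set.Ico (0 : ℝ) 1 := by
  rw [ae_all_iff]
  intro i
  refine ae_of_ae_map (f := U i) (p := fun t => t ∈ Set.Ico (0 : ℝ) 1) (hU.1 i).aemeasurable ?_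
  rw [hU.2.2 i]
  exact ae_restrict_mem measurableSet_Ico

namespace PastKernel

variable {A : Type*} [Encodable A] [Nonempty A] {P : PastKernel A} {τ : ContextTree A}
  {Ω : Type*} [MeasurableSpace Ω] {μ : Measure Ω} [IsProbabilityMeasure μ] {U : ℤ → Ω → ℝ}

lemma ae_of_ae_driveLaw (hU : IsIIDUniform μ U) (m : ℤ) {p : (ℕ → ℝ) → Prop}
    (h : ∀ᵐ s ∂driveLaw, p s) : ∀ᵐ ω ∂μ, p (backward (fun i => U i ω) m) := by
  rw [← map_backward_eq hU m] at h
  exact ae_of_ae_map (measurable_backward hU.1 m).aemeasurable h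

lemma measure_backward_preimage (hU : IsIIDUniform μ U) (m : ℤ) {C : Set (ℕ → ℝ)}
    (hC : MeasurableSet C) : μ {ω | backward (fun i => U i ω) m ∈ C} = driveLaw C := by
  rw [← map_backward_eq hU m, Measure.map_apply (measurable_backward hU.1 m) hC]
  rfl

lemma ae_hasBlocks (hU : IsIIDUniform μ U) {N : Ω → ℕ}
    (hN : ∀ᵐ ω ∂μ, P.IsBlock τ (backward (fun i => U i ω) 0) (N ω)) :
    ∀ᵐ s ∂driveLaw, P.HasBlocks τ s := by
  set E : Set (ℕ → ℝ) := ⋃ k, {s | P.IsBlock τ s k} with hE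
  have hEm : MeasurableSet E := MeasurableSet.iUnion fun k => P.measurableSet_isBlock τ k
  have h0 : ∀ᵐ s ∂driveLaw, s ∈ E := by
    rw [← map_backward_eq hU 0]
    refine (ae_map_iff (p := fun s => s ∈ E) (measurable_backward hU.1 0).aemeasurable hEm).2 ?_
    filter_upwards [hN] with ω hω
    exact Set.mem_iUnion.2 ⟨_, hω⟩
  refine ae_all_iff.2 fun n => ?_
  have h1 : ∀ᵐ s ∂driveLaw, shift n s ∈ E := by
    rw [← map_shift_driveLaw n] at h0
    exact ae_of_ae_map (measurable_shift n).aemeasurable h0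
  filter_upwards [h1] with s hs
  exact Set.mem_iUnion.1 hs

/-- The shortest block is at most as long as the given one. -/
lemma ae_blockLength_le {N : Ω → ℕ}
    (hN : ∀ᵐ ω ∂μ, P.IsBlock τ (backward (fun i => U i ω) 0) (N ω)) :
    ∀ᵐ ω ∂μ, P.blockLength τ (backward (fun i => U i ω) 0) ≤ N ω := by
  filter_upwards [hN] with ω hω using Nat.sInf_le hω

lemma lintegral_blockLength_le (hU : IsIIDUniform μ U) {θbar : Ω → ℤ}
    (hint : Integrable (fun ω => (θbar ω : ℝ)) μ)
    (hN : ∀ᵐ ω ∂μ, P.IsBlock τ (backward (fun i => U i ω) 0) ((θbar ω).natAbs + 1)) :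
    ∫⁻ s, (P.blockLength τ s : ENNReal) ∂driveLaw ≤
      ENNReal.ofReal ((∫ ω, |(θbar ω : ℝ)| ∂μ) + 1) := by
  have hf : Measurable fun s => (P.blockLength τ s : ENNReal) :=
    (measurable_of_countable (fun n : ℕ => (n : ENNReal))).comp (P.measurable_blockLength τ)
  have h1 : (∫ ω, |(θbar ω : ℝ)| ∂μ) + 1 = ∫ ω, (|(θbar ω : ℝ)| + 1) ∂μ := by
    rw [integral_add hint.abs (integrable_const 1)]; simp
  rw [← map_backward_eq hU 0, lintegral_map hf (measurable_backward hU.1 0), h1,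
    ofReal_integral_eq_lintegral_ofReal (f := fun ω => |(θbar ω : ℝ)| + 1) (hint.abs.add (integrable_const 1))
      (Eventually.of_forall fun ω => by positivity)]
  refine lintegral_mono_ae ?_
  filter_upwards [ae_blockLength_le hN] with ω hω
  rw [← ENNReal.ofReal_natCast]
  refine ENNReal.ofReal_le_ofReal ?_
  calc (P.blockLength τ (backward (fun i => U i ω) 0) : ℝ)
      ≤ (((θbar ω).natAbs + 1 : ℕ) : ℝ) := by exact_mod_cast hω
    _ = |(θbar ω : ℝ)| + 1 := by push_cast; rw [Nat.cast_natAbs]; push_cast; rfl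

/-! ### The number of older contexts needed by a block -/

lemma driveLaw_apply_eq (c : ℝ) (i : ℕ) : driveLaw {s | s i = c} = 0 := by
  have h : driveLaw.map (fun s => s i) = volume.restrict (Set.Ico (0 : ℝ) 1) :=
    Measure.infinitePi_map_eval (fun _ : ℕ => volume.restrict (Set.Ico (0 : ℝ) 1)) i
  have h1 := Measure.map_apply (μ := driveLaw) (measurable_pi_apply i) (measurableSet_singleton c)
  rw [h, measure_mono_null (Set.Subset.refl _) (by simp)] at h1
  exact h1.symm

lemma tsum_driveLaw_lt_blockLength :
    ∑' j : ℕ, driveLaw {s | j < P.blockLength τ s} =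
      ∫⁻ s, (P.blockLength τ s : ENNReal) ∂driveLaw := by
  have hm : ∀ j : ℕ, MeasurableSet {s | j < P.blockLength τ s} := fun j =>
    measurableSet_lt measurable_const (P.measurable_blockLength τ)
  simp_rw [← lintegral_indicator_one (hm _)]
  rw [← lintegral_tsum fun j => (measurable_one.indicator (hm j)).aemeasurable]
  congr 1; ext s
  rw [tsum_eq_sum (s := Finset.range (P.blockLength τ s))]
  · rw [Finset.sum_congr rfl (g := fun _ => 1)]
    · simp
    · intro j hj
      exact Set.indicator_of_mem (s := {s | j < P.blockLength τ s}) (Finset.mem_range.1 hj) _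
  · intro j hj
    exact Set.indicator_of_notMem (s := {s | j < P.blockLength τ s})
      (fun h => hj (Finset.mem_range.2 h)) _

/-- The probability that the driving variable exceeds `ᾱ_k^c`, where `c` is the largest length of a
context compatible with the earlier variables. -/
lemma measure_extRateLength_lt (hU : IsIIDUniform μ U) (k : ℕ) :
    μ {ω | P.extRateLength τ k (P.maxContextLength τ (fun i => U i ω) (-1)) < U 0 ω} =
      driveLaw {s | P.extRateLength τ k (P.backContext τ (shift 1 s)) ≤ s 0} := by
  have hg : Measurable fun s : ℕ → ℝ => P.extRateLength τ k (P.backContext τ (shift 1 s)) :=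
    (measurable_of_countable fun i : ℕ∞ => P.extRateLength τ k i).comp
      ((P.measurable_backContext τ).comp (measurable_shift 1))
  have h1 := measure_backward_preimage hU 0 (measurableSet_lt hg (measurable_pi_apply 0))
  have h2 : {ω | P.extRateLength τ k (P.maxContextLength τ (fun i => U i ω) (-1)) < U 0 ω} =
      {ω | backward (fun i => U i ω) 0 ∈
        {s : ℕ → ℝ | P.extRateLength τ k (P.backContext τ (shift 1 s)) < s 0}} := by
    ext ω
    simp only [Set.mem_ofPred_eq, maxContextLength_eq, shift_backward]
    simp only [backward, zero_sub, Nat.cast_zero, sub_zero, Nat.cast_one]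
    exact Iff.rfl
  rw [h2, h1]
  refine measure_congr ?_
  have hnull : ∀ᵐ s ∂driveLaw, ∀ i : ℕ∞, ¬ s 0 = P.extRateLength τ k i :=
    ae_all_iff.2 fun i => by
      rw [ae_iff]
      simpa using driveLaw_apply_eq (P.extRateLength τ k i) 0
  filter_upwards [hnull] with s hs
  refine propext ⟨fun h => le_of_lt h, fun h => lt_of_le_of_ne h fun h' => hs _ h'.symm⟩

/-- By Wald's identity, the expected number of times of the first block at which the driving variable
exceeds `ᾱ_k` is the expected length of the block times the probability of exceeding `ᾱ_k`. -/
lemma one_sub_needProb_le (hU : IsIIDUniform μ U) {θbar : Ω → ℤ}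
    (hint : Integrable (fun ω => (θbar ω : ℝ)) μ)
    (hN : ∀ᵐ ω ∂μ, P.IsBlock τ (backward (fun i => U i ω) 0) ((θbar ω).natAbs + 1)) (k : ℕ) :
    1 - P.needProb τ k ≤ ((∫ ω, |(θbar ω : ℝ)| ∂μ) + 1) * μ.real
      {ω | P.extRateLength τ k (P.maxContextLength τ (fun i => U i ω) (-1)) < U 0 ω} := by
  have hB := ae_hasBlocks hU hN
  have hg : Measurable fun s : ℕ → ℝ => P.extRateLength τ k (P.backContext τ (shift 1 s)) :=
    (measurable_of_countable fun i : ℕ∞ => P.extRateLength τ k i).comp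
      ((P.measurable_backContext τ).comp (measurable_shift 1))
  set R : Set (ℕ → ℝ) := {s | P.extRateLength τ k (P.backContext τ (shift 1 s)) ≤ s 0} with hR
  have hRm : MeasurableSet R := measurableSet_le hg (measurable_pi_apply 0)
  -- That the first block is longer than `j` is decided by the first `j` terms.
  set E : ℕ → Set (ℕ → ℝ) := fun j => {s | ∀ i ≤ j, ¬ P.IsBlock τ s i} with hE
  have hEm : ∀ j, MeasurableSet (E j) := fun j => by
    have : E j = ⋂ i ∈ Set.Iic j, {s | P.IsBlock τ s i}ᶜ := by ext s; simp [hE]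
    rw [this]
    exact MeasurableSet.biInter (Set.to_countable _) fun i _ => (P.measurableSet_isBlock τ i).compl
  have hEd : ∀ j, DependsOnFirst j (E j) := fun j s s' h hs i hi hb =>
    hs i hi ((isBlock_congr fun l hl => by rw [h l (by omega)]).1 hb)
  have hEle : ∀ j, driveLaw (E j) ≤ driveLaw {s | j < P.blockLength τ s} := fun j =>
    measure_mono_ae (by
      filter_upwards [hB] with s hs hsE
      by_contra hlt
      exact hsE _ (not_lt.1 hlt) hs.isBlock)
  have hsub : {s | P.NeedsAtMost τ k s}ᶜ ⊆ ⋃ j, E j ∩ shift j ⁻¹' R := by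
    intro s hs
    simp only [Set.mem_compl_iff, Set.mem_ofPred_eq, NeedsAtMost, not_forall, not_or,
      not_lt] at hs
    obtain ⟨j, hj, -, hle⟩ := hs
    refine Set.mem_iUnion.2 ⟨j, fun i hi hb => ?_, ?_⟩
    · exact absurd (Nat.sInf_le hb) (not_le.2 (hi.trans_lt hj))
    · simpa [hR, shift_shift] using hle
  have hmain : driveLaw {s | P.NeedsAtMost τ k s}ᶜ ≤
      ENNReal.ofReal ((∫ ω, |(θbar ω : ℝ)| ∂μ) + 1) * driveLaw R := by
    calc driveLaw {s | P.NeedsAtMost τ k s}ᶜ ≤ ∑' j, driveLaw (E j ∩ shift j ⁻¹' R) :=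
          (measure_mono hsub).trans (measure_iUnion_le _)
      _ = ∑' j, driveLaw (E j) * driveLaw R := by
          congr 1; ext j; exact driveLaw_inter_preimage_shift (hEm j) (hEd j) hRm
      _ = (∑' j, driveLaw (E j)) * driveLaw R := ENNReal.tsum_mul_right
      _ ≤ (∑' j : ℕ, driveLaw {s | j < P.blockLength τ s}) * driveLaw R := by
          exact mul_le_mul_left (ENNReal.tsum_le_tsum hEle) _
      _ ≤ _ := by
          rw [tsum_driveLaw_lt_blockLength]
          gcongr
          exact lintegral_blockLength_le hU hint hN
  have h0 : 0 ≤ (∫ ω, |(θbar ω : ℝ)| ∂μ) + 1 := by positivity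
  have h2 := ENNReal.toReal_mono (ENNReal.mul_ne_top ENNReal.ofReal_ne_top (measure_ne_top _ _)) hmain
  rw [ENNReal.toReal_mul, ENNReal.toReal_ofReal h0, ← measure_extRateLength_lt hU k] at h2
  rwa [needProb, ← probReal_compl_eq_one_sub (P.measurableSet_needsAtMost τ k)]

/-- With positive probability all symbols of the first block are forced: a block remains a block
when its free symbols are replaced by the symbol with which it starts. -/
lemma needProb_zero_pos (hB : ∀ᵐ s ∂driveLaw, P.HasBlocks τ s) : 0 < P.needProb τ 0 := by
  set lam : Measure ℝ := volume.restrict (Set.Ico (0 : ℝ) 1) with hlam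
  have hpos : ∀ᵐ s ∂driveLaw, ∀ i, lam {t | P.forced t = P.forced (s i)} ≠ 0 := by
    refine ae_all_iff.2 fun i => ?_
    have h : driveLaw.map (fun s => s i) = lam :=
      Measure.infinitePi_map_eval (fun _ : ℕ => volume.restrict (Set.Ico (0 : ℝ) 1)) i
    refine ae_of_ae_map (f := fun s : ℕ → ℝ => s i)
      (p := fun t' => lam {t | P.forced t = P.forced t'} ≠ 0) (measurable_pi_apply i).aemeasurable ?_
    rw [h, ae_iff]
    refine measure_mono_null (t := ⋃ o ∈ {o : Option A | lam {t | P.forced t = o} = 0},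
      {t | P.forced t = o}) (fun t ht => ?_) ?_
    · simp only [Set.mem_iUnion]
      exact ⟨P.forced t, by simpa using ht, rfl⟩
    · exact (measure_biUnion_null_iff (Set.to_countable _)).2 fun o ho => ho
  obtain ⟨s₀, hs₀, hp⟩ := (hB.and hpos).exists
  have hblk := hs₀.isBlock
  set k := P.blockLength τ s₀ with hk
  classical
  set o : ℕ → Option A := fun i =>
    if P.forced (s₀ i) = none then P.forced (s₀ (k - 1)) else P.forced (s₀ i) with ho
  have ho_pos : ∀ i, lam {t | P.forced t = o i} ≠ 0 := fun i => by
    simp only [ho]; split_ifs <;> exact hp _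
  have ho_ne : ∀ i, o i ≠ none := fun i => by
    simp only [ho]; split_ifs with h
    · exact hblk.2.1
    · exact h
  have hE : driveLaw ((Finset.range k : Set ℕ).pi fun i => {t | P.forced t = o i}) ≠ 0 := by
    rw [driveLaw, Measure.infinitePi_pi _ fun i _ => P.measurableSet_forced_eq _]
    exact Finset.prod_ne_zero_iff.2 fun i _ => ho_pos i
  refine ENNReal.toReal_pos (fun h0 => hE (measure_mono_null (fun s hs => ?_) h0))
    (measure_ne_top _ _)
  have hs' : ∀ i < k, P.forced (s i) = o i := fun i hi =>
    hs i (Finset.mem_coe.2 (Finset.mem_range.2 hi))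
  have hbs : P.IsBlock τ s k := hblk.mono fun i hi => by
    rw [hs' i hi]
    simp only [ho]
    split_ifs with h
    · exact Or.inl h
    · exact Or.inr rfl
  refine fun j hj => Or.inl ?_
  rw [hs' j (hj.trans_le (Nat.sInf_le hbs))]
  exact ho_ne j

lemma needProb_eq_one_of_alphaTotal (h : P.alphaTotal = 1) (k : ℕ) : P.needProb τ k = 1 := by
  have h1 : ∀ᵐ s ∂driveLaw, P.NeedsAtMost τ k s := by
    filter_upwards [ae_driveLaw_mem_Ico] with s hs j _
    exact Or.inl (forced_ne_none_of_alphaTotal h (hs j))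
  rw [needProb, Measure.real, (mem_ae_iff_prob_eq_one (P.measurableSet_needsAtMost τ k)).1 h1,
    ENNReal.toReal_one]

end PastKernel

/-! ### Tails of the coalescence time -/

lemma tsum_ite_succ_le (x : ENNReal) :
    ∑' n : ℕ, (if ((n + 1 : ℕ) : ENNReal) ≤ x then (1 : ENNReal) else 0) ≤ x := by
  refine ENNReal.tsum_le_of_sum_range_le fun n => ?_
  induction n with
  | zero => simp
  | succ n ih =>
    rw [Finset.sum_range_succ]
    split_ifs with h
    · refine le_trans ?_ h
      rw [Nat.cast_add, Nat.cast_one]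
      gcongr
      calc ∑ i ∈ Finset.range n, (if ((i + 1 : ℕ) : ENNReal) ≤ x then (1 : ENNReal) else 0)
          ≤ ∑ i ∈ Finset.range n, (1 : ENNReal) :=
            Finset.sum_le_sum fun i _ => by split_ifs <;> simp
        _ = n := by simp
    · simpa using ih

namespace PastKernel

variable {A : Type*} [Encodable A] [Nonempty A] {P : PastKernel A} {τ : ContextTree A}

lemma HasBlocks.iterate {s : ℕ → ℝ} (h : P.HasBlocks τ s) (n : ℕ) :
    P.HasBlocks τ ((P.dropBlock τ)^[n] s) := by
  induction n generalizing s with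
  | zero => exact h
  | succ n ih => exact ih (h.shift _)

/-- If there is a renewal up to `M`, then the symbol at time `m` is determined by the variables
of the first `M` blocks. -/
lemma coalescenceLag_lt_totalLength {u : ℤ → ℝ} {m : ℤ} (hu : ∀ i, u i ∈ Set.Ico (0 : ℝ) 1)
    (hs : P.HasBlocks τ (backward u m)) {M : ℕ} (hM : ¬ P.NoRenewal τ M (backward u m)) :
    coalescenceLag (P.update τ) u m m < (P.totalLength τ M (backward u m) : ℕ∞) := by
  simp only [NoRenewal, not_forall, not_not] at hM
  obtain ⟨k, hk1, hkM, hk⟩ := hM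
  have hpos : 0 < P.totalLength τ k (backward u m) := by
    obtain ⟨k, rfl⟩ : ∃ l, k = l + 1 := ⟨k - 1, by omega⟩
    have := hs.isBlock.1
    rw [totalLength]; omega
  refine (coalescenceLag_lt_of_forgets hpos
    (forgets_of_isRenewal (fun n => (hu _).1) hs hk)).trans_le ?_
  exact_mod_cast totalLength_mono (backward u m) hkM

variable {Ω : Type*} [MeasurableSpace Ω] {μ : Measure Ω} [IsProbabilityMeasure μ] {U : ℤ → Ω → ℝ}

/-- If the renewals are recurrent, then each time coalesces almost surely. -/
lemma ae_coalescenceLag_lt_top (hU : IsIIDUniform μ U) (hB : ∀ᵐ s ∂driveLaw, P.HasBlocks τ s)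
    (hr : Tendsto (P.noRenewalProb τ) atTop (𝓝 0)) :
    ∀ᵐ ω ∂μ, ∀ m : ℤ, coalescenceLag (P.update τ) (fun i => U i ω) m m < ⊤ := by
  rw [ae_all_iff]
  intro m
  have h0 : ∀ᵐ s ∂driveLaw, ∃ M, ¬ P.NoRenewal τ M s := by
    rw [ae_iff]
    have hle : ∀ M, driveLaw.real {s | ¬ ∃ M, ¬ P.NoRenewal τ M s} ≤ P.noRenewalProb τ M :=
      fun M => measureReal_mono fun s hs => by
        by_contra hM
        exact hs ⟨M, hM⟩
    have h1 : driveLaw.real {s | ¬ ∃ M, ¬ P.NoRenewal τ M s} = 0 :=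
      le_antisymm (ge_of_tendsto' hr hle) measureReal_nonneg
    exact (measureReal_eq_zero_iff).1 h1
  filter_upwards [ae_mem_Ico hU, ae_of_ae_driveLaw hU m hB, ae_of_ae_driveLaw hU m h0]
    with ω h1 h2 ⟨M, hM⟩
  exact (coalescenceLag_lt_totalLength h1 h2 hM).trans (WithTop.coe_lt_top _)

lemma isFeasible_update (hU : IsIIDUniform μ U) (hB : ∀ᵐ s ∂driveLaw, P.HasBlocks τ s)
    (hr : Tendsto (P.noRenewalProb τ) atTop (𝓝 0)) : IsFeasible μ U (P.update τ) := by
  intro m n _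
  filter_upwards [ae_coalescenceLag_lt_top hU hB hr] with ω hω
  exact coalescenceLag_lt_top hω m n

/-- The total length of the blocks up to the first renewal. -/
noncomputable def renewalLength (P : PastKernel A) (τ : ContextTree A) (s : ℕ → ℝ) : ENNReal :=
  ∑' n, {s | P.NoRenewal τ n s}.indicator
    (fun s => (P.blockLength τ ((P.dropBlock τ)^[n] s) : ENNReal)) s

lemma measurable_blockLength_iterate (n : ℕ) :
    Measurable fun s => (P.blockLength τ ((P.dropBlock τ)^[n] s) : ENNReal) :=
  (measurable_of_countable (fun n : ℕ => (n : ENNReal))).comp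
    ((P.measurable_blockLength τ).comp (measurable_iterate_dropBlock n))

lemma measurable_renewalLength : Measurable (P.renewalLength τ) :=
  Measurable.tsum fun n =>
    (measurable_blockLength_iterate n).indicator (P.measurableSet_noRenewal τ n)

lemma lintegral_renewalLength (hB : ∀ᵐ s ∂driveLaw, P.HasBlocks τ s) :
    ∫⁻ s, P.renewalLength τ s ∂driveLaw = (∑' n, ENNReal.ofReal (P.noRenewalProb τ n)) *
      ∫⁻ s, (P.blockLength τ s : ENNReal) ∂driveLaw := by
  unfold renewalLength
  rw [lintegral_tsum fun n => ((measurable_blockLength_iterate n).indicator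
    (P.measurableSet_noRenewal τ n)).aemeasurable, ← ENNReal.tsum_mul_right]
  congr 1; ext n
  rw [lintegral_indicator (P.measurableSet_noRenewal τ n), lintegral_noRenewal_blockLength hB]

lemma succ_le_renewalLength {u : ℤ → ℝ} {m : ℤ} (hu : ∀ i, u i ∈ Set.Ico (0 : ℝ) 1)
    (hs : P.HasBlocks τ (backward u m)) {n : ℕ}
    (hn : (n : ℕ∞) ≤ coalescenceLag (P.update τ) u m m) :
    ((n + 1 : ℕ) : ENNReal) ≤ P.renewalLength τ (backward u m) := by
  classical
  set s := backward u m
  have hterm : ∀ M, (∀ i < M, P.NoRenewal τ i s) →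
      (P.totalLength τ M s : ENNReal) ≤ P.renewalLength τ s := fun M hM => by
    rw [totalLength_eq_sum, Nat.cast_sum]
    refine le_trans (le_of_eq (Finset.sum_congr rfl fun i hi => ?_))
      (ENNReal.sum_le_tsum (Finset.range M))
    rw [Set.indicator_of_mem]
    exact hM i (Finset.mem_range.1 hi)
  by_cases h : ∃ M, ¬ P.NoRenewal τ M s
  · have hlag := hn.trans_lt (coalescenceLag_lt_totalLength hu hs (Nat.find_spec h))
    have hlt : n < P.totalLength τ (Nat.find h) s := by exact_mod_cast hlag
    refine le_trans ?_ (hterm (Nat.find h) fun i hi => not_not.1 (Nat.find_min h hi))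
    exact_mod_cast hlt
  · have hall : ∀ i, P.NoRenewal τ i s := by simpa using h
    refine le_trans ?_ (hterm (n + 1) fun i _ => hall i)
    rw [totalLength_eq_sum]
    have : ∑ i ∈ Finset.range (n + 1), 1 ≤
        ∑ i ∈ Finset.range (n + 1), P.blockLength τ ((P.dropBlock τ)^[i] s) :=
      Finset.sum_le_sum fun i _ => (hs.iterate i).isBlock.1
    rw [Finset.sum_const, Finset.card_range, smul_eq_mul, mul_one] at this
    exact_mod_cast this

lemma hasSummableTail_coalescenceLag (hU : IsIIDUniform μ U)
    (hB : ∀ᵐ s ∂driveLaw, P.HasBlocks τ s) (hr : Summable (P.noRenewalProb τ))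
    (hlen : ∫⁻ s, (P.blockLength τ s : ENNReal) ∂driveLaw ≠ ⊤) :
    HasSummableTail μ fun ω => coalescenceLag (P.update τ) (fun i => U i ω) 0 0 := by
  have hE : ∀ n : ℕ, MeasurableSet {s | ((n + 1 : ℕ) : ENNReal) ≤ P.renewalLength τ s} := fun n =>
    measurableSet_le measurable_const measurable_renewalLength
  have h1 : ∀ n : ℕ, μ {ω | (n : ℕ∞) ≤ coalescenceLag (P.update τ) (fun i => U i ω) 0 0} ≤
      driveLaw {s | ((n + 1 : ℕ) : ENNReal) ≤ P.renewalLength τ s} := fun n => by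
    rw [← measure_backward_preimage hU 0 (hE n)]
    refine measure_mono_ae ?_
    filter_upwards [ae_mem_Ico hU, ae_of_ae_driveLaw hU 0 hB] with ω h1 h2 h3
    exact succ_le_renewalLength h1 h2 h3
  refine ENNReal.summable_toReal (ne_top_of_le_ne_top ?_ (ENNReal.tsum_le_tsum h1))
  have h2 : ∑' n : ℕ, driveLaw {s | ((n + 1 : ℕ) : ENNReal) ≤ P.renewalLength τ s} ≤
      ∫⁻ s, P.renewalLength τ s ∂driveLaw := by
    simp_rw [← lintegral_indicator_one (hE _)]
    rw [← lintegral_tsum fun n => (measurable_one.indicator (hE n)).aemeasurable]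
    refine lintegral_mono fun s => ?_
    refine le_trans (le_of_eq ?_) (tsum_ite_succ_le _)
    congr 1; ext n
    simp [Set.indicator_apply]
  refine ne_top_of_le_ne_top ?_ h2
  rw [lintegral_renewalLength hB]
  refine ENNReal.mul_ne_top ?_ hlen
  rw [← ENNReal.ofReal_tsum_of_nonneg (f := P.noRenewalProb τ) (fun _ => measureReal_nonneg) hr]
  exact ENNReal.ofReal_ne_top

/-- An exponential tail of the lengths of the blocks gives a finite exponential moment. -/
lemma exists_lintegral_pow_blockLength_ne_top {D d : ℝ} (hd0 : 0 < d) (hd1 : d < 1)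
    (h : ∀ n, driveLaw.real {s | n < P.blockLength τ s} ≤ D * d ^ n) :
    ∃ β : ℝ, 1 < β ∧ ∫⁻ s, ENNReal.ofReal β ^ P.blockLength τ s ∂driveLaw ≠ ⊤ := by
  set β : ℝ := 2 / (1 + d) with hβ
  have hβ1 : 1 < β := by rw [hβ, lt_div_iff₀ (by linarith)]; linarith
  have hdβ : d * β < 1 := by rw [hβ, mul_div_assoc', div_lt_one (by linarith)]; linarith
  have hβ0 : 0 < β := by linarith
  refine ⟨β, hβ1, ?_⟩
  have hpow : Measurable fun n : ℕ => ENNReal.ofReal β ^ n := measurable_of_countable _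
  have h1 : ∫⁻ s, ENNReal.ofReal β ^ P.blockLength τ s ∂driveLaw =
      ∑' n : ℕ, ENNReal.ofReal β ^ n * driveLaw (P.blockLength τ ⁻¹' {n}) := by
    rw [← lintegral_map hpow (P.measurable_blockLength τ), lintegral_countable']
    congr 1; ext n
    rw [Measure.map_apply (P.measurable_blockLength τ) (measurableSet_singleton n)]
  rw [h1, tsum_eq_zero_add' ENNReal.summable]
  refine ENNReal.add_ne_top.2 ⟨ENNReal.mul_ne_top (by simp) (measure_ne_top _ _), ?_⟩
  have hs : Summable fun n : ℕ => D * β * (d * β) ^ n :=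
    (summable_geometric_of_lt_one (by positivity) hdβ).mul_left _
  have hD : 0 ≤ D := by simpa using measureReal_nonneg.trans (h 0)
  have h2 : ∀ n : ℕ, ENNReal.ofReal β ^ (n + 1) * driveLaw (P.blockLength τ ⁻¹' {n + 1}) ≤
      ENNReal.ofReal (D * β * (d * β) ^ n) := fun n => by
    have h3 : driveLaw (P.blockLength τ ⁻¹' {n + 1}) ≤ ENNReal.ofReal (D * d ^ n) := by
      refine le_trans (measure_mono fun s hs => ?_)
        ((ENNReal.le_ofReal_iff_toReal_le (measure_ne_top _ _) (by positivity)).2 (h n))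
      have : P.blockLength τ s = n + 1 := hs
      show n < P.blockLength τ s
      omega
    calc ENNReal.ofReal β ^ (n + 1) * driveLaw (P.blockLength τ ⁻¹' {n + 1})
        ≤ ENNReal.ofReal (β ^ (n + 1)) * ENNReal.ofReal (D * d ^ n) := by
          rw [ENNReal.ofReal_pow hβ0.le]; gcongr
      _ = ENNReal.ofReal (D * β * (d * β) ^ n) := by
          rw [← ENNReal.ofReal_mul (by positivity)]
          congr 1; rw [mul_pow]; ring
  refine ne_top_of_le_ne_top ?_ (ENNReal.tsum_le_tsum h2)
  rw [← ENNReal.ofReal_tsum_of_nonneg (fun n => by positivity) hs]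
  exact ENNReal.ofReal_ne_top

/-- Chernoff's bound: the first `⌊n / q⌋` blocks are unlikely to be longer than `n`. -/
lemma exists_measure_lt_totalLength_le (hB : ∀ᵐ s ∂driveLaw, P.HasBlocks τ s) {β : ℝ}
    (hβ : 1 < β) (hfin : ∫⁻ s, ENNReal.ofReal β ^ P.blockLength τ s ∂driveLaw ≠ ⊤) :
    ∃ q : ℕ, 1 ≤ q ∧ ∃ κ : ℝ, 0 < κ ∧ κ < 1 ∧ ∀ n,
      driveLaw.real {s | n < P.totalLength τ (n / q) s} ≤ κ ^ n := by
  set B : ℝ := (∫⁻ s, ENNReal.ofReal β ^ P.blockLength τ s ∂driveLaw).toReal with hBdef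
  have hB0 : 0 ≤ B := ENNReal.toReal_nonneg
  obtain ⟨q, hq⟩ := pow_unbounded_of_one_lt (B ^ 2) hβ
  have hβ0 : 0 < β := by linarith
  set σ : ℝ := Real.sqrt β with hσ
  have hσ2 : σ ^ 2 = β := Real.sq_sqrt hβ0.le
  have hσ1 : 1 < σ := by rw [hσ, Real.lt_sqrt zero_le_one]; simpa using hβ
  have hσ0 : 0 < σ := by linarith
  refine ⟨q + 1, by omega, σ⁻¹, by positivity, inv_lt_one_of_one_lt₀ hσ1, fun n => ?_⟩
  set M := n / (q + 1) with hM
  have hMn : (q + 1) * M ≤ n := Nat.mul_div_le n (q + 1)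
  -- The expectation of `β ^ length` over the `M` blocks is at most `σ ^ n`.
  have hBM : B ^ M ≤ σ ^ n := by
    refine le_of_sq_le_sq ?_ (by positivity)
    calc (B ^ M) ^ 2 = (B ^ 2) ^ M := by rw [← pow_mul, ← pow_mul, mul_comm]
      _ ≤ (β ^ (q + 1)) ^ M := by
          gcongr
          exact hq.le.trans (pow_le_pow_right₀ hβ.le q.le_succ)
      _ = β ^ ((q + 1) * M) := by rw [pow_mul]
      _ ≤ β ^ n := pow_le_pow_right₀ hβ.le hMn
      _ = (σ ^ n) ^ 2 := by rw [← hσ2, ← pow_mul, ← pow_mul, mul_comm]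
  have hpow : Measurable fun s => ENNReal.ofReal β ^ P.totalLength τ M s :=
    (measurable_of_countable fun n : ℕ => ENNReal.ofReal β ^ n).comp (P.measurable_totalLength τ M)
  have hmarkov := mul_meas_ge_le_lintegral (μ := driveLaw) hpow (ENNReal.ofReal β ^ n)
  rw [lintegral_pow_totalLength hB] at hmarkov
  have hsub : driveLaw {s | n < P.totalLength τ M s} ≤
      driveLaw {s | ENNReal.ofReal β ^ n ≤ ENNReal.ofReal β ^ P.totalLength τ M s} :=
    measure_mono fun s hs => by
      show ENNReal.ofReal β ^ n ≤ ENNReal.ofReal β ^ P.totalLength τ M s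
      exact pow_le_pow_right₀ (by simpa using hβ.le) (le_of_lt hs)
  have h1 : ENNReal.ofReal β ^ n * driveLaw {s | n < P.totalLength τ M s} ≤
      (∫⁻ s, ENNReal.ofReal β ^ P.blockLength τ s ∂driveLaw) ^ M :=
    (mul_le_mul_right hsub _).trans hmarkov
  have h2 := ENNReal.toReal_mono (ENNReal.pow_ne_top hfin) h1
  rw [ENNReal.toReal_mul, ENNReal.toReal_pow, ENNReal.toReal_pow, ENNReal.toReal_ofReal hβ0.le,
    ← hBdef] at h2
  have h3 : σ ^ n * (σ ^ n * driveLaw.real {s | n < P.totalLength τ M s}) ≤ σ ^ n * 1 := by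
    rw [← mul_assoc, ← mul_pow, ← sq, hσ2, mul_one]
    exact h2.trans hBM
  have h4 := le_of_mul_le_mul_left h3 (by positivity)
  rw [inv_pow, ← one_div, le_div_iff₀ (by positivity), mul_comm]
  exact h4

lemma hasExponentialTail_coalescenceLag (hU : IsIIDUniform μ U)
    (hB : ∀ᵐ s ∂driveLaw, P.HasBlocks τ s) {θ : ℝ} (hθ : 1 < θ)
    (hr : ∀ M, P.noRenewalProb τ M ≤ θ⁻¹ ^ M) {D d : ℝ} (hd0 : 0 < d) (hd1 : d < 1)
    (h : ∀ n, driveLaw.real {s | n < P.blockLength τ s} ≤ D * d ^ n) :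
    HasExponentialTail μ fun ω => coalescenceLag (P.update τ) (fun i => U i ω) 0 0 := by
  obtain ⟨β, hβ, hfin⟩ := exists_lintegral_pow_blockLength_ne_top hd0 hd1 h
  obtain ⟨q, hq, κ, hκ0, hκ1, hκ⟩ := exists_measure_lt_totalLength_le hB hβ hfin
  have hθ0 : 0 < θ := by linarith
  set η : ℝ := θ⁻¹ ^ ((q : ℝ)⁻¹) with hη
  have hq0 : (q : ℝ) ≠ 0 := by positivity
  have hη0 : 0 < η := by positivity
  have hη1 : η < 1 := Real.rpow_lt_one (by positivity) (inv_lt_one_of_one_lt₀ hθ) (by positivity)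
  have hηq : η ^ q = θ⁻¹ := by
    rw [hη, ← Real.rpow_natCast, ← Real.rpow_mul (by positivity), inv_mul_cancel₀ hq0,
      Real.rpow_one]
  have hηn : ∀ n : ℕ, θ⁻¹ ^ (n / q) ≤ θ * η ^ n := fun n => by
    have hn : n ≤ q * (n / q) + q := by
      have := Nat.div_add_mod n q
      have := Nat.mod_lt n (show 0 < q by omega)
      omega
    calc θ⁻¹ ^ (n / q) = θ * η ^ (q * (n / q) + q) := by
          rw [pow_add, pow_mul, hηq]; field_simp
      _ ≤ θ * η ^ n := by
          gcongr ?_ * ?_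
          exact pow_le_pow_of_le_one hη0.le hη1.le hn
  refine ⟨θ + 1, by positivity, max η κ, lt_max_of_lt_left hη0, max_lt hη1 hκ1, fun n => ?_⟩
  set M := n / q
  have hE1 := P.measurableSet_noRenewal τ M
  have hE2 : MeasurableSet {s | n < P.totalLength τ M s} :=
    measurableSet_lt measurable_const (P.measurable_totalLength τ M)
  have h1 : μ {ω | (n : ℕ∞) ≤ coalescenceLag (P.update τ) (fun i => U i ω) 0 0} ≤
      driveLaw ({s | P.NoRenewal τ M s} ∪ {s | n < P.totalLength τ M s}) := by
    rw [← measure_backward_preimage hU 0 (hE1.union hE2)]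
    refine measure_mono_ae ?_
    filter_upwards [ae_mem_Ico hU, ae_of_ae_driveLaw hU 0 hB] with ω h1 h2 h3
    refine or_iff_not_imp_left.2 fun h4 => ?_
    have := (show (n : ℕ∞) ≤ _ from h3).trans_lt (coalescenceLag_lt_totalLength h1 h2 h4)
    exact_mod_cast this
  calc μ.real {ω | (n : ℕ∞) ≤ coalescenceLag (P.update τ) (fun i => U i ω) 0 0}
      ≤ driveLaw.real ({s | P.NoRenewal τ M s} ∪ {s | n < P.totalLength τ M s}) :=
        ENNReal.toReal_mono (measure_ne_top _ _) h1
    _ ≤ P.noRenewalProb τ M + driveLaw.real {s | n < P.totalLength τ M s} :=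
        measureReal_union_le _ _
    _ ≤ θ * η ^ n + κ ^ n := add_le_add ((hr M).trans (hηn n)) (hκ n)
    _ ≤ θ * max η κ ^ n + max η κ ^ n := by
        gcongr
        · exact le_max_left _ _
        · exact le_max_right _ _
    _ = (θ + 1) * max η κ ^ n := by ring

end PastKernel

/-! ### Comparison with the sequence `Ā_k` -/

section Comparison

variable {a p x : ℕ → ℝ} {α : ℝ}

/-- The bound `1 - p ≤ x` gives `1 - p ≤ C (1 - max (1 - x) α)`: where the maximum is `α`, the
right-hand side is `C (1 - α)`. -/
lemma exists_one_sub_le_mul (ha : ∀ k, a k = max (1 - x k) α) (hx0 : ∀ k, 0 ≤ x k)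
    (hpx : ∀ k, 1 - p k ≤ x k) (hp0 : ∀ k, 0 ≤ p k) (hα1 : α ≤ 1) (hα : α = 1 → ∀ k, p k = 1) :
    ∃ C > 0, ∀ k, 1 - p k ≤ C * (1 - a k) := by
  rcases hα1.lt_or_eq with h | h
  · have h' : 0 < 1 - α := by linarith
    refine ⟨max 1 (1 - α)⁻¹, by positivity, fun k => ?_⟩
    rw [ha k]
    rcases le_total α (1 - x k) with h1 | h1
    · rw [max_eq_left h1, sub_sub_cancel]
      exact (hpx k).trans (le_mul_of_one_le_left (hx0 k) (le_max_left _ _))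
    · rw [max_eq_right h1]
      calc 1 - p k ≤ 1 := by linarith [hp0 k]
        _ = (1 - α)⁻¹ * (1 - α) := (inv_mul_cancel₀ h'.ne').symm
        _ ≤ _ := mul_le_mul_of_nonneg_right (le_max_right _ _) h'.le
  · refine ⟨1, one_pos, fun k => ?_⟩
    rw [hα h k, ha k, h, max_eq_right (by linarith [hx0 k])]
    norm_num

/-- Nonsummability of the products of the `a j` is inherited by the products of the `p j`, since
`a ≤ p` from some index on, unless `a` is constant and less than one. -/
lemma not_summable_prod (ha : ∀ k, a k = max (1 - x k) α) (hx0 : ∀ k, 0 ≤ x k) (hx : Antitone x)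
    (hpx : ∀ k, 1 - p k ≤ x k) {δ : ℝ} (hδ : 0 < δ) (hp : ∀ k, δ ≤ p k) (hα0 : 0 ≤ α)
    (hα1 : α ≤ 1) (hα : α = 1 → ∀ k, p k = 1)
    (hns : ¬ Summable fun k => ∏ j ∈ Finset.range (k + 1), a j) :
    ¬ Summable fun m => ∏ j ∈ Finset.range m, p j := by
  have ha0 : ∀ k, 0 ≤ a k := fun k => hα0.trans (by rw [ha k]; exact le_max_right _ _)
  have ha1 : ∀ k, a k ≤ 1 := fun k => by
    rw [ha k]; exact max_le (by linarith [hx0 k]) hα1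
  obtain ⟨K, hK⟩ : ∃ K, ∀ k, a (K + k) ≤ p (K + k) := by
    rcases hα1.lt_or_eq with h | h
    · by_cases hex : ∃ K, α < 1 - x K
      · obtain ⟨K, hK⟩ := hex
        refine ⟨K, fun k => ?_⟩
        have h1 := hx (Nat.le_add_right K k)
        rw [ha, max_eq_left (by linarith)]
        linarith [hpx (K + k)]
      · refine absurd ?_ hns
        have haα : ∀ k, a k = α := fun k => by
          rw [ha k]; exact max_eq_right (not_lt.1 fun h => hex ⟨k, h⟩)
        simp only [haα, Finset.prod_const, Finset.card_range]
        exact (summable_nat_add_iff 1).2 (summable_geometric_of_lt_one hα0 h)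
    · exact ⟨0, fun k => by rw [hα h]; exact ha1 _⟩
  intro hs
  refine hns ((summable_nat_add_iff K).1 ?_)
  have hs' : Summable fun k => (δ ^ K)⁻¹ * ∏ j ∈ Finset.range (K + (k + 1)), p j := by
    refine Summable.mul_left _ ?_
    have := (summable_nat_add_iff (K + 1)).2 hs
    refine this.congr fun k => ?_
    congr 2; ring
  refine hs'.of_nonneg_of_le (fun k => Finset.prod_nonneg fun j _ => ha0 j) fun k => ?_
  have hsplit : k + K + 1 = K + (k + 1) := by ring
  rw [hsplit, Finset.prod_range_add a K (k + 1), Finset.prod_range_add p K (k + 1)]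
  have h1 : ∏ j ∈ Finset.range K, a j ≤ 1 :=
    Finset.prod_le_one (fun j _ => ha0 j) fun j _ => ha1 j
  have h2 : ∏ j ∈ Finset.range (k + 1), a (K + j) ≤ ∏ j ∈ Finset.range (k + 1), p (K + j) :=
    Finset.prod_le_prod (fun j _ => ha0 _) fun j _ => hK j
  have h3 : δ ^ K ≤ ∏ j ∈ Finset.range K, p j := by
    calc δ ^ K = ∏ j ∈ Finset.range K, δ := by simp
      _ ≤ _ := Finset.prod_le_prod (fun _ _ => hδ.le) fun j _ => hp j
  have h4 : 0 ≤ ∏ j ∈ Finset.range (k + 1), p (K + j) :=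
    Finset.prod_nonneg fun j _ => hδ.le.trans (hp _)
  calc (∏ j ∈ Finset.range K, a j) * ∏ j ∈ Finset.range (k + 1), a (K + j)
      ≤ 1 * ∏ j ∈ Finset.range (k + 1), p (K + j) :=
        mul_le_mul h1 h2 (Finset.prod_nonneg fun j _ => ha0 _) zero_le_one
    _ = (δ ^ K)⁻¹ * (δ ^ K * ∏ j ∈ Finset.range (k + 1), p (K + j)) := by
        rw [inv_mul_cancel_left₀ (by positivity), one_mul]
    _ ≤ _ := by gcongr

end Comparison

namespace PastKernel

variable {A : Type*} [Encodable A] [Nonempty A] {P : PastKernel A} {τ : ContextTree A}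

lemma needProb_zero_le (k : ℕ) : P.needProb τ 0 ≤ P.needProb τ k := needProb_mono k.zero_le

/-- If the number of older contexts needed by a block has a finite mean, then the probabilities of
the renewals are bounded below. -/
lemma exists_le_renewalProb (hB : ∀ᵐ s ∂driveLaw, P.HasBlocks τ s)
    (hs : Summable fun k => 1 - P.needProb τ k) : ∃ c > 0, ∀ m, c ≤ P.renewalProb τ m := by
  obtain ⟨c, hc, h⟩ := exists_le_prod_of_summable (needProb_zero_pos hB) needProb_zero_le
    needProb_le_one hs
  exact ⟨c, hc, fun m => by rw [renewalProb_eq_prod hB]; exact h m⟩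

lemma tendsto_noRenewalProb (hB : ∀ᵐ s ∂driveLaw, P.HasBlocks τ s)
    (hns : ¬ Summable fun m => ∏ j ∈ Finset.range m, P.needProb τ j) :
    Tendsto (P.noRenewalProb τ) atTop (𝓝 0) := by
  refine tendsto_zero_of_renewal (u := P.renewalProb τ) (fun _ => measureReal_nonneg)
    (fun _ => measureReal_nonneg) noRenewalProb_antitone (sum_renewalProb_mul_noRenewalProb hB) ?_
  rwa [show P.renewalProb τ = _ from funext (renewalProb_eq_prod hB)]

lemma summable_noRenewalProb (hB : ∀ᵐ s ∂driveLaw, P.HasBlocks τ s)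
    (hs : Summable fun k => 1 - P.needProb τ k) : Summable (P.noRenewalProb τ) := by
  obtain ⟨c, hc, h⟩ := exists_le_renewalProb hB hs
  exact summable_of_renewal hc h (fun _ => measureReal_nonneg)
    (sum_renewalProb_mul_noRenewalProb hB)

lemma exists_noRenewalProb_le (hB : ∀ᵐ s ∂driveLaw, P.HasBlocks τ s) {C ρ : ℝ} (hC : 0 < C)
    (hρ0 : 0 < ρ) (hρ1 : ρ < 1) (h : ∀ k, 1 - P.needProb τ k ≤ C * ρ ^ k) :
    ∃ θ : ℝ, 1 < θ ∧ ∀ M, P.noRenewalProb τ M ≤ θ⁻¹ ^ M := by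
  have hs : Summable fun k => 1 - P.needProb τ k :=
    ((summable_geometric_of_lt_one hρ0.le hρ1).mul_left C).of_nonneg_of_le
      (fun k => sub_nonneg.2 (needProb_le_one k)) h
  obtain ⟨c, hc, hu⟩ := exists_le_renewalProb hB hs
  refine exists_geometric_of_renewal hc renewalProb_zero hu (renewalProb_antitone hB)
    noRenewalProb_zero (sum_renewalProb_mul_noRenewalProb hB) hC hρ0 hρ1 fun m => ?_
  rw [renewalProb_succ hB, ← one_sub_mul]
  exact (mul_le_of_le_one_right (sub_nonneg.2 (needProb_le_one m)) measureReal_le_one).trans (h m)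

end PastKernel

end InfiniteChain

open InfiniteChain InfiniteChain.PastKernel

theorem theorem2 {A : Type*} [Encodable A] [Nonempty A]
    {Ω : Type*} [MeasurableSpace Ω] (μ : Measure Ω) [IsProbabilityMeasure μ]
    (U : ℤ → Ω → ℝ) (hU : InfiniteChain.IsIIDUniform μ U)
    (P : InfiniteChain.PastKernel A) (τ : InfiniteChain.ContextTree A)
    (hτ : τ.IsSkeleton) (hP : P.IsExtLC τ)
    (θbar : Ω → ℤ) (hint : Integrable (fun ω => (θbar ω : ℝ)) μ)
    (hgood : ∀ᵐ ω ∂μ, P.IsGoodTime τ (fun i => U i ω) 0 (θbar ω))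
    (hwindow : ∀ᵐ ω ∂μ, P.ContextsInWindow τ (fun i => U i ω) 0 (θbar ω)) :
    ∃ F : Stream' A → ℝ → A, P.IsUpdateFunction F ∧
      -- regime (i)
      ((¬ Summable fun k : ℕ =>
          ∏ j ∈ Finset.range (k + 1), InfiniteChain.extA μ U P τ θbar j) →
        (∀ᵐ ω ∂μ, InfiniteChain.coalescenceLag F (fun i => U i ω) 0 0 < ⊤) ∧
          InfiniteChain.IsFeasible μ U F) ∧
      -- regime (ii)
      ((Summable fun k : ℕ => 1 - InfiniteChain.extA μ U P τ θbar k) →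
        InfiniteChain.HasSummableTail μ
            (fun ω => InfiniteChain.coalescenceLag F (fun i => U i ω) 0 0) ∧
          InfiniteChain.IsFeasible μ U F) ∧
      -- regime (iii)
      (InfiniteChain.HasExponentialTail μ (fun ω => ((θbar ω).natAbs : ℕ∞)) ∧
          (InfiniteChain.DecaysExponentially
            fun k : ℕ => 1 - InfiniteChain.extA μ U P τ θbar k) →
        InfiniteChain.HasExponentialTail μ
            (fun ω => InfiniteChain.coalescenceLag F (fun i => U i ω) 0 0) ∧
          InfiniteChain.IsFeasible μ U F) := by
  set a : ℕ → ℝ := extA μ U P τ θbar with ha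
  set x : ℕ → ℝ := fun k => ((∫ ω, |(θbar ω : ℝ)| ∂μ) + 1) * μ.real
    {ω | P.extRateLength τ k (P.maxContextLength τ (fun i => U i ω) (-1)) < U 0 ω} with hx
  have hax : ∀ k, a k = max (1 - x k) P.alphaTotal := fun k => rfl
  have hN : ∀ᵐ ω ∂μ, P.IsBlock τ (backward (fun i => U i ω) 0) ((θbar ω).natAbs + 1) := by
    filter_upwards [hgood, hwindow, ae_mem_Ico hU] with ω h1 h2 h3
    exact isBlock_of_isGoodTime hP h3 h1 h2
  have hB := ae_hasBlocks hU hN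
  have hpx : ∀ k, 1 - P.needProb τ k ≤ x k := one_sub_needProb_le hU hint hN
  have hx0 : ∀ k, 0 ≤ x k := fun k => by positivity
  have hxanti : Antitone x := fun j k hjk => by
    refine mul_le_mul_of_nonneg_left (measureReal_mono fun ω hω => ?_) (by positivity)
    exact (P.extRateLength_mono τ _ hjk).trans_lt hω
  have hα : P.alphaTotal = 1 → ∀ k, P.needProb τ k = 1 := needProb_eq_one_of_alphaTotal
  obtain ⟨C, hC, hCa⟩ := exists_one_sub_le_mul hax hx0 hpx (fun k => measureReal_nonneg)
    P.alphaTotal_le_one hα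
  have hlen : ∫⁻ s, (P.blockLength τ s : ENNReal) ∂driveLaw ≠ ⊤ :=
    ne_top_of_le_ne_top ENNReal.ofReal_ne_top (lintegral_blockLength_le hU hint hN)
  have hsum : (Summable fun k => 1 - a k) → Summable fun k => 1 - P.needProb τ k := fun h =>
    (h.mul_left C).of_nonneg_of_le (fun k => sub_nonneg.2 (needProb_le_one k)) hCa
  refine ⟨P.update τ, P.isUpdateFunction_update τ hP, fun hns => ?_, fun hs => ?_, ?_⟩
  · have hr := tendsto_noRenewalProb hB (not_summable_prod hax hx0 hxanti hpx
      (needProb_zero_pos hB) needProb_zero_le P.alphaTotal_nonneg P.alphaTotal_le_one hα hns)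
    refine ⟨?_, isFeasible_update hU hB hr⟩
    filter_upwards [ae_coalescenceLag_lt_top hU hB hr] with ω hω using hω 0
  · have hr := summable_noRenewalProb hB (hsum hs)
    exact ⟨hasSummableTail_coalescenceLag hU hB hr hlen,
      isFeasible_update hU hB hr.tendsto_atTop_zero⟩
  · rintro ⟨⟨D, hD, d, hd0, hd1, htail⟩, E, hE, ρ, hρ0, hρ1, hdecay⟩
    have hdec : ∀ k, 1 - P.needProb τ k ≤ C * E * ρ ^ k := fun k =>
      (hCa k).trans (by rw [mul_assoc]; exact mul_le_mul_of_nonneg_left (hdecay k) hC.le)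
    obtain ⟨θ, hθ, hr⟩ := exists_noRenewalProb_le hB (by positivity) hρ0 hρ1 hdec
    have hlim : Filter.Tendsto (P.noRenewalProb τ) Filter.atTop (nhds 0) :=
      squeeze_zero (fun _ => measureReal_nonneg) hr
        (tendsto_pow_atTop_nhds_zero_of_lt_one (by positivity) (inv_lt_one_of_one_lt₀ hθ))
    refine ⟨hasExponentialTail_coalescenceLag (D := D) hU hB hθ hr hd0 hd1 fun n => ?_,
      isFeasible_update hU hB hlim⟩
    have hm : MeasurableSet {s | n < P.blockLength τ s} :=
      measurableSet_lt measurable_const (P.measurable_blockLength τ)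
    refine le_trans (ENNReal.toReal_mono (measure_ne_top _ _) ?_) (htail n)
    rw [← measure_backward_preimage hU 0 hm]
    refine measure_mono_ae ?_
    filter_upwards [ae_blockLength_le hN] with ω hω hlt
    have hlt' : n < P.blockLength τ (backward (fun i => U i ω) 0) := hlt
    show (n : ℕ∞) ≤ ((θbar ω).natAbs : ℕ∞)
    exact_mod_cast (by omega : n ≤ (θbar ω).natAbs)
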